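/- Let $K$ be a perfect field of characteristic $2$ and let $\mathfrak H(K)=\{x+x^2 : x\in K\}$, an additive subgroup of $K$. For a quadratic form $Q$ on a finite-dimensional $K$-vector space $V$ put $B(x,y)=Q(x+y)-Q(x)-Q(y)$. For vectors $x,y\in V$ let $\operatorname{Arf}\langle x,y\rangle = Q(x)Q(y)/B(x,y)^2\in K$ if $B(x,y)\neq 0$ and $\operatorname{Arf}\langle x,y\rangle=\infty$ if $B(x,y)=0$; this does not change when $x,y$ are multiplied by non-zero scalars, so it is defined for points of $\mathbb P V$. If $B$ is non-degenerate, choose a decomposition of $V$ into mutually orthogonal planes with bases $e_i,f_i$ ($B(e_i,f_i)\ne0$); then $\operatorname{Arf} V\in K/\mathfrak H(K)$ is the class of $\sum_i Q(e_i)Q(f_i)/B(e_i,f_i)^2$. A universal conformal geometry (of even dimension $\dim V-4$) is a tuple $(V,Q,\Omega,P,L)$ where $Q$ is a quadratic form on $V$ with $B$ non-degenerate and $\Omega,P,L\in\mathbb P V$ are points such that the radical $\{v\in\Omega^\perp : Q(v+u)=Q(u)\ \text{for all } u\in\Omega^\perp\}$ of $Q|_{\Omega^\perp}$ is zero; $P\perp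 L$; $\Omega,P,L$ are linearly independent; $Q(P)\ne 0$ or $\operatorname{Arf}\langle\Omega,P\rangle\neq\infty$; and $Q(L)\ne 0$ or $\operatorname{Arf}\langle\Omega,L\rangle\neq\infty$. Two geometries $(V,Q,\Omega,P,L)$, $(V',Q',\Omega',P',L')$ are isometric if there is a linear bijection $\varphi:V\to V'$ with $Q'\circ\varphi=Q$ that maps the points $\Omega,P,L$ to $\Omega',P',L'$. Theorem. 1. For every geometry, $\operatorname{Arf}V$ is well defined as an element of $K/\mathfrak H(K)$. 2. Two geometries with $\dim V=\dim V'$ are isometric if and only if $\operatorname{Arf}V=\operatorname{Arf}V'$ in $K/\mathfrak H(K)$, $\operatorname{Arf}\langle\Omega,P\rangle=\operatorname{Arf}\langle\Omega',P'\rangle$ and $\operatorname{Arf}\langle\Omega,L\rangle=\operatorname{Arf}\langle\Omega',L'\rangle$ in $K\cup\{\infty\}$. 3. In every geometry the point $\Omega$ has exactly one representative vector $\omega$ with $Q(\omega)=1$. 4. In every geometry $\dim V$ is even and at least $4$. 5. If $\dim V\ge 6$ is even, then for all $a\in K/\mathfrak H(K)$ and all $\alpha,\beta\in K\cup\{\infty\}$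 there is a geometry on $V$ with $\operatorname{Arf}V=a$, $\operatorname{Arf}\langle\Omega,P\rangle=\alpha$ and $\operatorname{Arf}\langle\Omega,L\rangle=\beta$. 6. If $\dim V=4$, then for $a\in K/\mathfrak H(K)$ and $\alpha,\beta\in K\cup\{\infty\}$ a geometry on $V$ with these values exists if and only if $\alpha\ne\beta$, or $\alpha=\beta\in K$ and $a=\alpha+\mathfrak H(K)$. -/

import Mathlib

open scoped LinearAlgebra.Projectivization OnePoint

namespace CharTwoGeometry

/-- The additive operator `x ↦ x + x²` of a field of characteristic two. -/
def artinSchreier (K : Type*) [Field K] [CharP K 2] : K →+ K where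
  toFun x := x + x ^ 2
  map_zero' := by simp
  map_add' x y := by rw [CharTwo.add_sq]; ring

/-- The additive subgroup `𝔥(K) = {x + x² : x ∈ K}` of `K`. -/
def frakH (K : Type*) [Field K] [CharP K 2] : AddSubgroup K := (artinSchreier K).range

section Vectors

variable {K V : Type*} [Field K] [AddCommGroup V] [Module K V]

/-- The Arf value `Arf⟨x, y⟩ ∈ K ∪ {∞}` of two vectors:
`Q(x) Q(y) / B(x, y)²` if `B(x, y) ≠ 0`, and `∞` if `B(x, y) = 0`, where
`B(x, y) = Q(x + y) - Q(x) - Q(y)`. -/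
noncomputable def arfPair (Q : QuadraticForm K V) (x y : V) : OnePoint K :=
  open Classical in
  if QuadraticMap.polar Q x y = 0 then ∞
  else ((Q x * Q y / QuadraticMap.polar Q x y ^ 2 : K) : OnePoint K)

theorem arfPair_smul (Q : QuadraticForm K V) {a b : K} (ha : a ≠ 0) (hb : b ≠ 0) (x y : V) :
    arfPair Q (a • x) (b • y) = arfPair Q x y := by
  have h : QuadraticMap.polar Q (a • x) (b • y) = a * b * QuadraticMap.polar Q x y := by
    rw [QuadraticMap.polar_smul_left, QuadraticMap.polar_smul_right]
    simp only [smul_eq_mul]; ring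
  unfold arfPair
  rw [h, QuadraticMap.map_smul, QuadraticMap.map_smul]
  by_cases h0 : QuadraticMap.polar Q x y = 0
  · simp [h0]
  · rw [if_neg h0, if_neg (mul_ne_zero (mul_ne_zero ha hb) h0)]
    congr 1
    simp only [smul_eq_mul]
    field_simp

/-- The Arf value `Arf⟨p, q⟩ ∈ K ∪ {∞}` of two points of the projective space. -/
noncomputable def arfPoints (Q : QuadraticForm K V) (p q : ℙ K V) : OnePoint K :=
  arfPair Q p.rep q.rep

/-- `arfPoints` can be computed from arbitrary representatives. -/
theorem arfPoints_mk (Q : QuadraticForm K V) {x y : V} (hx : x ≠ 0) (hy : y ≠ 0) :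
    arfPoints Q (Projectivization.mk K x hx) (Projectivization.mk K y hy) = arfPair Q x y := by
  obtain ⟨a, ha⟩ := Projectivization.exists_smul_eq_mk_rep K x hx
  obtain ⟨b, hb⟩ := Projectivization.exists_smul_eq_mk_rep K y hy
  unfold arfPoints
  rw [← ha, ← hb]
  exact arfPair_smul Q a.ne_zero b.ne_zero x y

/-- `a ∈ K / 𝔥(K)` is an Arf invariant of `(V, Q)`: for some decomposition of `V` into mutually
orthogonal planes with bases `e i = b (i, 0)`, `f i = b (i, 1)` and `B(e i, f i) ≠ 0`, the sum
of the values `Q(e i) Q(f i) / B(e i, f i)²` has class `a`. -/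
def HasArf [CharP K 2] (Q : QuadraticForm K V) (a : K ⧸ frakH K) : Prop :=
  ∃ (k : ℕ) (b : Module.Basis (Fin k × Fin 2) K V),
    (∀ i j, i ≠ j → ∀ s t, QuadraticMap.polar Q (b (i, s)) (b (j, t)) = 0) ∧
    (∀ i, QuadraticMap.polar Q (b (i, 0)) (b (i, 1)) ≠ 0) ∧
    a = ((∑ i, Q (b (i, 0)) * Q (b (i, 1)) /
      QuadraticMap.polar Q (b (i, 0)) (b (i, 1)) ^ 2 : K) : K ⧸ frakH K)

end Vectors

/-- A universal conformal geometry `(V, Q, Ω, P, L)` of even dimension `dim V - 4` on the vector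
space `V`. -/
structure Geometry (K V : Type*) [Field K] [AddCommGroup V] [Module K V] where
  /-- the quadratic form -/
  Q : QuadraticForm K V
  Ω : ℙ K V
  P : ℙ K V
  L : ℙ K V
  /-- `Q` has a non-degenerate associated bilinear form -/
  nondegenerate : Q.polarBilin.Nondegenerate
  /-- the virtual quadratic space `(V, Q, Ω^⊥)` is non-degenerate: the radical of the restriction
  of `Q` to `Ω^⊥`, i.e. `{v ∈ Ω^⊥ | Q(v + u) = Q(u) for all u ∈ Ω^⊥}`, is trivial -/
  radical_restrict : (Q.restrict (LinearMap.BilinForm.orthogonal Q.polarBilin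
    Ω.submodule)).radical = ⊥
  /-- `P` and `L` are orthogonal -/
  orthogonal : ∀ p ∈ P.submodule, ∀ l ∈ L.submodule, QuadraticMap.polar Q p l = 0
  /-- `Ω`, `P`, `L` are linearly independent -/
  independent : Projectivization.Independent ![Ω, P, L]
  /-- `Q(P) ≠ 0` or `Arf⟨Ω, P⟩ ≠ ∞` -/
  nonsingular_P : Q P.rep ≠ 0 ∨ arfPoints Q Ω P ≠ ∞
  /-- `Q(L) ≠ 0` or `Arf⟨Ω, L⟩ ≠ ∞` -/
  nonsingular_L : Q L.rep ≠ 0 ∨ arfPoints Q Ω L ≠ ∞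

/-- Two geometries are isometric if a linear bijection that carries one quadratic form to the other
maps the points `Ω`, `P`, `L` of the first to those of the second (as vectors: up to scalars). -/
def Geometry.IsIsometric {K V V' : Type*} [Field K] [AddCommGroup V] [Module K V]
    [AddCommGroup V'] [Module K V'] (G : Geometry K V) (G' : Geometry K V') : Prop :=
  ∃ φ : G.Q.IsometryEquiv G'.Q,
    Projectivization.map φ.toLinearEquiv.toLinearMap φ.toLinearEquiv.injective G.Ω = G'.Ω ∧
    Projectivization.map φ.toLinearEquiv.toLinearMap φ.toLinearEquiv.injective G.P = G'.P ∧
    Projectivization.map φ.toLinearEquiv.toLinearMap φ.toLinearEquiv.injective G.L = G'.L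

end CharTwoGeometry

/-! If `B(e, f) = 1`, the space is the orthogonal sum of the plane of `e`, `f` and its complement,
so inductions run over the number of planes. `IsArf` is the Arf invariant in a form adapted to this.

The Arf class does not depend on the splitting. Any two pairs `(e, f)`, `(e', f')` are linked
through a vector `g` that is orthogonal to neither `e` nor `e'`, so it is enough to change one
vector of a pair (`IsArfAt.change_right`). This replaces the form on the complement by `Q + Q(e)
B(w, ·)²`. By `IsArf.twist` this shifts the Arf class by `Q(e) Q(w)`, which is also the shift,
modulo `𝔥(K)`, of the contribution of the plane; in characteristic two the shifts cancel.

Over a perfect field every scalar is a square, so a non-degenerate form on a non-zero space takes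
all values. Hence two non-zero vectors with the same value, in spaces with the same dimension and
Arf class, have partners with the same value (`IsArf.exists_partners`). Induction on the complement
gives the classification by dimension and Arf class, and Witt extension for one vector, then for the
configurations needed here.

For a geometry, the radical condition says `Q(Ω) ≠ 0`, so `Ω` has a representative with value one.
`P` and `L` are normalized by `B(Ω, ·) = 1` if the Arf value is finite, and by `Q = 1` if it is `∞`.
Then the Arf values determine all values of `Q` and `B` on the three vectors, and Witt extension
gives the isometry. Existence comes from explicit vectors in orthogonal sums of planes. In dimension
four, two values `∞` would give a three-dimensional subspace on which `B` vanishes, and two equal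
finite values put a singular vector into the complement of the plane of `Ω` and `P`, which makes the
Arf class of that complement zero. -/

namespace CharTwoGeometry

open QuadraticMap Module

universe u v w

/-! ### Splitting a quadratic space by a plane. -/

section Splitting

variable {K : Type*} [Field K]
variable {V : Type u} [AddCommGroup V] [Module K V]
variable {V' : Type v} [AddCommGroup V'] [Module K V']

theorem polar_isometryEquiv {Q : QuadraticForm K V} {Q' : QuadraticForm K V'}
    (φ : Q.IsometryEquiv Q') (x y : V) : polar Q' (φ x) (φ y) = polar Q x y := by
  simp only [polar, ← map_add, φ.map_app]

/-- The orthogonal complement of the span of `e` and `f`. -/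
def planeComplement (Q : QuadraticForm K V) (e f : V) : Submodule K V :=
  LinearMap.ker (Q.polarBilin e) ⊓ LinearMap.ker (Q.polarBilin f)

theorem mem_planeComplement {Q : QuadraticForm K V} {e f x : V} :
    x ∈ planeComplement Q e f ↔ polar Q e x = 0 ∧ polar Q f x = 0 := by
  simp [planeComplement]

theorem planeComplement_comm (Q : QuadraticForm K V) (e f : V) :
    planeComplement Q e f = planeComplement Q f e :=
  inf_comm _ _

theorem planeComplement_smul (Q : QuadraticForm K V) (e f : V) {s t : K} (hs : s ≠ 0)
    (ht : t ≠ 0) : planeComplement Q (s • e) (t • f) = planeComplement Q e f := by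
  ext x
  simp [mem_planeComplement, polar_smul_left, hs, ht]

/-- The quadratic form `a x² + x y + c y²` on the plane. -/
def planeForm (a c : K) : QuadraticForm K (K × K) :=
  linMulLin (a • LinearMap.fst K K K + LinearMap.snd K K K) (LinearMap.fst K K K) +
    linMulLin (c • LinearMap.snd K K K) (LinearMap.snd K K K)

theorem planeForm_apply (a c : K) (x : K × K) :
    planeForm a c x = a * x.1 ^ 2 + x.1 * x.2 + c * x.2 ^ 2 := by
  simp [planeForm]; ring

theorem nondegenerate_iff {Q : QuadraticForm K V} :
    Q.polarBilin.Nondegenerate ↔ ∀ x, (∀ y, polar Q x y = 0) → x = 0 := by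
  constructor
  · intro h x hx
    exact h.1 x hx
  · intro h
    exact ⟨h, fun y hy => h y fun x => by rw [polar_comm]; exact hy x⟩

theorem map_smul_add_smul_add (Q : QuadraticForm K V) {e f w : V} (h : polar Q e f = 1)
    (hw : w ∈ planeComplement Q e f) (x y : K) :
    Q (x • e + y • f + w) = Q e * x ^ 2 + x * y + Q f * y ^ 2 + Q w := by
  rw [mem_planeComplement] at hw
  rw [QuadraticMap.map_add Q, QuadraticMap.map_add Q]
  simp only [QuadraticMap.map_smul, polar_add_left, polar_smul_left, polar_smul_right, h, hw.1,
    hw.2, smul_eq_mul]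
  ring

/-- An isometry restricts to the complements of corresponding planes. -/
def planeComplementIso {Q : QuadraticForm K V} {Q' : QuadraticForm K V'}
    (φ : Q.IsometryEquiv Q') (e f : V) :
    (Q.restrict (planeComplement Q e f)).IsometryEquiv
      (Q'.restrict (planeComplement Q' (φ e) (φ f))) where
  toLinearEquiv := φ.toLinearEquiv.ofSubmodules _ _ (by
    ext x
    obtain ⟨x, rfl⟩ := φ.toLinearEquiv.surjective x
    rw [Submodule.mem_map_equiv, LinearEquiv.symm_apply_apply, mem_planeComplement,
      mem_planeComplement]
    change _ ↔ polar Q' (φ e) (φ x) = 0 ∧ polar Q' (φ f) (φ x) = 0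
    rw [polar_isometryEquiv, polar_isometryEquiv])
  map_app' x := φ.map_app x

theorem exists_polar_eq_one {Q : QuadraticForm K V} (hQ : Q.polarBilin.Nondegenerate) {x : V}
    (hx : x ≠ 0) : ∃ y, polar Q x y = 1 := by
  have : ∃ y, polar Q x y ≠ 0 := by
    by_contra! h
    exact hx (nondegenerate_iff.1 hQ x h)
  obtain ⟨y, hy⟩ := this
  exact ⟨(polar Q x y)⁻¹ • y, by rw [polar_smul_right, smul_eq_mul, inv_mul_cancel₀ hy]⟩

/-- Two proper subspaces, here the kernels of `B(e, ·)` and `B(e', ·)`, do not cover the space. The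
vector `g` links two arbitrary pairs in `IsArfAt.change`. -/
theorem exists_polar_ne_zero_and {Q : QuadraticForm K V} {e f e' f' : V} (h : polar Q e f ≠ 0)
    (h' : polar Q e' f' ≠ 0) : ∃ g, polar Q e g ≠ 0 ∧ polar Q e' g ≠ 0 := by
  by_cases h1 : polar Q e' f = 0
  · by_cases h2 : polar Q e f' = 0
    · exact ⟨f + f', by simpa [polar_add_right, h2] using h, by simpa [polar_add_right, h1] using h'⟩
    · exact ⟨f', h2, h'⟩
  · exact ⟨f, h, h1⟩

/-- The quadratic form `Q + d B(w, ·)²`, which has the same polar form as `Q`. -/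
def twist (Q : QuadraticForm K V) (d : K) (w : V) : QuadraticForm K V :=
  Q + d • linMulLin (Q.polarBilin w) (Q.polarBilin w)

theorem twist_apply (Q : QuadraticForm K V) (d : K) (w x : V) :
    twist Q d w x = Q x + d * polar Q w x ^ 2 := by
  simp [twist, pow_two]

theorem map_add_smul_of_polar_eq_one {Q : QuadraticForm K V} {u v : V} (h : polar Q u v = 1)
    (t : K) : Q (v + t • u) = Q v + t ^ 2 * Q u + t := by
  rw [QuadraticMap.map_add Q, QuadraticMap.map_smul, polar_smul_right, polar_comm Q v, h]
  simp only [smul_eq_mul]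
  ring

variable [CharP K 2]

theorem polar_self_eq_zero (Q : QuadraticForm K V) (x : V) : polar Q x x = 0 := by
  rw [polar_self, two_smul, CharTwo.add_self_eq_zero]

/-- A vector is the sum of its components in the plane of `e`, `f` and in the complement. -/
def splitEquiv (Q : QuadraticForm K V) {e f : V} (h : polar Q e f = 1) :
    V ≃ₗ[K] (K × K) × planeComplement Q e f where
  toFun x := ((polar Q f x, polar Q e x), ⟨x - polar Q f x • e - polar Q e x • f, by
    rw [mem_planeComplement]
    simp [polar_sub_right, polar_smul_right, CharTwo.two_eq_zero, h, polar_comm Q f e]⟩)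
  map_add' x y := by
    ext <;> simp [polar_add_right]
    module
  map_smul' c x := by
    ext <;> simp [polar_smul_right, smul_sub, mul_smul]
  invFun p := p.1.1 • e + p.1.2 • f + p.2
  left_inv x := by simp
  right_inv p := by
    obtain ⟨⟨x, y⟩, w, hw⟩ := p
    rw [mem_planeComplement] at hw
    have h1 : polar Q f (x • e + y • f + w) = x := by
      simp [polar_add_right, polar_smul_right, CharTwo.two_eq_zero, h, polar_comm Q f e, hw.2]
    have h2 : polar Q e (x • e + y • f + w) = y := by
      simp [polar_add_right, polar_smul_right, CharTwo.two_eq_zero, h, hw.1]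
    ext
    · exact h1
    · exact h2
    · simp only [h1, h2]; module

theorem exists_eq_smul_add_smul_add (Q : QuadraticForm K V) {e f : V} (h : polar Q e f = 1)
    (v : V) : ∃ (x y : K) (w : V), w ∈ planeComplement Q e f ∧ v = x • e + y • f + w :=
  ⟨_, _, _, (splitEquiv Q h v).2.2, ((splitEquiv Q h).symm_apply_apply v).symm⟩

/-- The splitting of a quadratic space by a plane on which the polar form does not vanish. -/
def splitIso (Q : QuadraticForm K V) {e f : V} (h : polar Q e f = 1) :
    Q.IsometryEquiv ((planeForm (Q e) (Q f)).prod (Q.restrict (planeComplement Q e f))) where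
  toLinearEquiv := splitEquiv Q h
  map_app' x := by
    have hx := (splitEquiv Q h).symm_apply_apply x
    conv_rhs => rw [← hx]
    simp only [prod_apply, planeForm_apply, restrict_apply]
    exact (map_smul_add_smul_add Q h (splitEquiv Q h x).2.2 _ _).symm

/-- The gluing step behind every inductive construction of an isometry: match a plane, then use an
isometry of the complements. -/
theorem exists_isometryEquiv_of_planeComplement {Q : QuadraticForm K V}
    {Q' : QuadraticForm K V'} {e f : V} {e' f' : V'} (h : polar Q e f = 1)
    (h' : polar Q' e' f' = 1) (he : Q e = Q' e') (hf : Q f = Q' f')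
    (φ : (Q.restrict (planeComplement Q e f)).IsometryEquiv
      (Q'.restrict (planeComplement Q' e' f'))) :
    ∃ ψ : Q.IsometryEquiv Q', ψ e = e' ∧ ψ f = f' ∧
      ∀ w : planeComplement Q e f, ψ (w : V) = φ w := by
  let ρ : ((planeForm (Q e) (Q f)).prod (Q.restrict (planeComplement Q e f))).IsometryEquiv
      ((planeForm (Q' e') (Q' f')).prod (Q'.restrict (planeComplement Q' e' f'))) :=
    { toLinearEquiv := (LinearEquiv.refl K (K × K)).prodCongr φ.toLinearEquiv
      map_app' := fun x => by
        have := φ.map_app x.2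
        simp only [prod_apply, he, hf]
        rw [← this]; rfl }
  have key : ∀ (x y : K) (w : planeComplement Q e f),
      ((splitIso Q h).trans (ρ.trans (splitIso Q' h').symm)) (x • e + y • f + w) =
        x • e' + y • f' + φ w := by
    intro x y w
    have : (splitIso Q h) (x • e + y • f + w) = ((x, y), w) :=
      (splitEquiv Q h).apply_symm_apply ((x, y), w)
    change (splitIso Q' h').symm (ρ ((splitIso Q h) (x • e + y • f + w))) = _
    rw [this]
    rfl
  refine ⟨(splitIso Q h).trans (ρ.trans (splitIso Q' h').symm), ?_, ?_, fun w => ?_⟩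
  · simpa using key 1 0 0
  · simpa using key 0 1 0
  · simpa using key 0 0 w

theorem nondegenerate_restrict_planeComplement {Q : QuadraticForm K V} {e f : V}
    (h : polar Q e f = 1) : (Q.restrict (planeComplement Q e f)).polarBilin.Nondegenerate ↔
      Q.polarBilin.Nondegenerate := by
  rw [nondegenerate_iff, nondegenerate_iff]
  constructor
  · intro hW x hx
    have hxW : x ∈ planeComplement Q e f :=
      mem_planeComplement.2 ⟨by rw [polar_comm]; exact hx e, by rw [polar_comm]; exact hx f⟩
    have := hW ⟨x, hxW⟩ fun y => hx y
    simpa using this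
  · rintro hQ ⟨x, hx⟩ hxW
    have : x = 0 := hQ x fun y => by
      obtain ⟨s, t, w, hw, rfl⟩ := exists_eq_smul_add_smul_add Q h y
      rw [mem_planeComplement] at hx
      have : polar Q x w = 0 := hxW ⟨w, hw⟩
      rw [polar_add_right, polar_add_right, polar_smul_right, polar_smul_right, polar_comm Q x e,
        polar_comm Q x f, hx.1, hx.2, this, smul_zero, smul_zero, add_zero, add_zero]
    simpa using this

theorem finrank_planeComplement [FiniteDimensional K V] (Q : QuadraticForm K V) {e f : V}
    (h : polar Q e f = 1) : finrank K V = finrank K (planeComplement Q e f) + 2 := by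
  rw [(splitEquiv Q h).finrank_eq, finrank_prod, finrank_prod, finrank_self]
  ring

end Splitting

/-! ### The Arf invariant and its independence of the splitting. -/

section ArfInvariant

variable {K : Type*} [Field K] [CharP K 2]

theorem mk_eq_mk_of_eq_add {a b : K} (t : K) (h : a = b + (t + t ^ 2)) :
    (a : K ⧸ frakH K) = b := by
  have ht : ((t + t ^ 2 : K) : K ⧸ frakH K) = 0 :=
    (QuotientAddGroup.eq_zero_iff _).2 ⟨t, rfl⟩
  rw [h, QuotientAddGroup.mk_add, ht, add_zero]

theorem exists_of_mk_eq_mk {a b : K} (h : (a : K ⧸ frakH K) = b) :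
    ∃ t : K, a = b + (t + t ^ 2) := by
  obtain ⟨t, ht⟩ := QuotientAddGroup.eq.1 h.symm
  refine ⟨t, ?_⟩
  change t + t ^ 2 = -b + a at ht
  rw [ht]; ring

/-- `a` is the sum of the classes of the Arf values of the planes of an orthogonal splitting of the
space into `n` planes, chosen one after the other. -/
def IsArf : ℕ → ∀ {V : Type u} [AddCommGroup V] [Module K V],
    QuadraticForm K V → K ⧸ frakH K → Prop
  | 0, V, _, _, _, a => Subsingleton V ∧ a = 0
  | n + 1, V, _, _, Q, a => ∃ e f : V, polar Q e f = 1 ∧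
      ∃ c, IsArf n (Q.restrict (planeComplement Q e f)) c ∧ a = ((Q e * Q f : K) : K ⧸ frakH K) + c

variable {V : Type u} [AddCommGroup V] [Module K V]
variable {V' : Type v} [AddCommGroup V'] [Module K V']

/-- `a` is an Arf value of the space that is computed from the plane of `e` and `f` and a splitting
of its complement into `n` planes. -/
def IsArfAt (n : ℕ) (Q : QuadraticForm K V) (e f : V) (a : K ⧸ frakH K) : Prop :=
  polar Q e f = 1 ∧
    ∃ c, IsArf n (Q.restrict (planeComplement Q e f)) c ∧ a = ((Q e * Q f : K) : K ⧸ frakH K) + c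

theorem isArf_succ {n : ℕ} {Q : QuadraticForm K V} {a : K ⧸ frakH K} :
    IsArf (n + 1) Q a ↔ ∃ e f : V, IsArfAt n Q e f a := Iff.rfl

theorem IsArf.of_isometryEquiv {n : ℕ} {Q : QuadraticForm K V} {Q' : QuadraticForm K V'}
    {a : K ⧸ frakH K} (h : IsArf n Q a) (φ : Q.IsometryEquiv Q') : IsArf n Q' a := by
  induction n generalizing V V' a with
  | zero =>
    obtain ⟨hV, rfl⟩ := h
    exact ⟨φ.toLinearEquiv.symm.injective.subsingleton, rfl⟩
  | succ n ih =>
    obtain ⟨e, f, hef, c, hc, rfl⟩ := h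
    refine ⟨φ e, φ f, by rw [polar_isometryEquiv, hef], c, ih hc (planeComplementIso φ e f), ?_⟩
    rw [φ.map_app, φ.map_app]

theorem IsArf.nondegenerate {n : ℕ} {Q : QuadraticForm K V} {a : K ⧸ frakH K}
    (h : IsArf n Q a) : Q.polarBilin.Nondegenerate := by
  induction n generalizing V a with
  | zero =>
    have := h.1
    exact nondegenerate_iff.2 fun x _ => Subsingleton.elim _ _
  | succ n ih =>
    obtain ⟨e, f, hef, c, hc, rfl⟩ := h
    exact (nondegenerate_restrict_planeComplement hef).1 (ih hc)

theorem IsArf.finrank [FiniteDimensional K V] {n : ℕ} {Q : QuadraticForm K V} {a : K ⧸ frakH K}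
    (h : IsArf n Q a) : finrank K V = 2 * n := by
  induction n generalizing V a with
  | zero =>
    have := h.1
    simp [finrank_zero_of_subsingleton]
  | succ n ih =>
    obtain ⟨e, f, hef, c, hc, rfl⟩ := h
    rw [finrank_planeComplement Q hef, ih hc, mul_add]

theorem exists_isArf [FiniteDimensional K V] {Q : QuadraticForm K V}
    (hQ : Q.polarBilin.Nondegenerate) : ∃ n a, IsArf n Q a := by
  induction hd : finrank K V using Nat.strong_induction_on generalizing V with
  | _ d ih =>
    rcases subsingleton_or_nontrivial V with hV | hV
    · exact ⟨0, 0, hV, rfl⟩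
    · obtain ⟨e, he⟩ := exists_ne (0 : V)
      obtain ⟨f, hef⟩ := exists_polar_eq_one hQ he
      have := finrank_planeComplement Q hef
      obtain ⟨n, c, hc⟩ := ih _ (by omega) ((nondegenerate_restrict_planeComplement hef).2 hQ) rfl
      exact ⟨n + 1, _, e, f, hef, c, hc, rfl⟩

theorem polar_twist (Q : QuadraticForm K V) (d : K) (w x y : V) :
    polar (twist Q d w) x y = polar Q x y := by
  simp only [polar, twist_apply]
  rw [← polar, ← polar, ← polar, polar_add_right, CharTwo.add_sq]
  ring

theorem planeComplement_twist (Q : QuadraticForm K V) (d : K) (w e f : V) :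
    planeComplement (twist Q d w) e f = planeComplement Q e f := by
  ext x
  simp only [mem_planeComplement, polar_twist]

/-- The component `x e + y f` of the twisting vector changes `Q(e)` by `d y²` and `Q(f)` by `d x²`.
Modulo `𝔥(K)` the product changes by `d Q(x e + y f)`. The component in the complement twists the
complement, where induction applies. -/
theorem IsArf.twist {n : ℕ} {Q : QuadraticForm K V} {a : K ⧸ frakH K} (h : IsArf n Q a) (d : K)
    (w : V) : IsArf n (twist Q d w) (a + ((d * Q w : K) : K ⧸ frakH K)) := by
  induction n generalizing V a with
  | zero =>
    obtain ⟨hV, rfl⟩ := h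
    refine ⟨hV, ?_⟩
    rw [Subsingleton.elim w 0, QuadraticMap.map_zero, mul_zero, zero_add]
    rfl
  | succ n ih =>
    obtain ⟨e, f, hef, c, hc, rfl⟩ := h
    obtain ⟨x, y, w, hw, rfl⟩ := exists_eq_smul_add_smul_add Q hef w
    set u := x • e + y • f + w with hu
    refine ⟨e, f, by rw [polar_twist, hef], c + ((d * Q w : K) : K ⧸ frakH K), ?_, ?_⟩
    · rw [planeComplement_twist]
      have : (CharTwoGeometry.twist Q d u).restrict (planeComplement Q e f) =
          CharTwoGeometry.twist (Q.restrict (planeComplement Q e f)) d ⟨w, hw⟩ := by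
        ext ⟨z, hz⟩
        have h1 : polar Q u z = polar Q w z := by
          rw [mem_planeComplement] at hz
          rw [hu, polar_add_left, polar_add_left, polar_smul_left, polar_smul_left, hz.1, hz.2,
            smul_zero, smul_zero, zero_add, zero_add]
        rw [restrict_apply, twist_apply, twist_apply]
        simp only [h1]
        rfl
      rw [this]
      exact ih hc ⟨w, hw⟩
    · rw [mem_planeComplement] at hw
      have he : polar Q u e = y := by
        rw [polar_comm]
        simp [hu, polar_add_right, polar_smul_right, CharTwo.two_eq_zero, hef, hw.1]
      have hf : polar Q u f = x := by
        rw [polar_comm]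
        simp [hu, polar_add_right, polar_smul_right, CharTwo.two_eq_zero, polar_comm Q f e, hef,
          hw.2]
      rw [twist_apply, twist_apply, he, hf, hu,
        map_smul_add_smul_add Q hef (mem_planeComplement.2 hw)]
      -- The two sides differ by `d x y + (d x y)²`, up to a multiple of two.
      have key := mk_eq_mk_of_eq_add (a := (Q e + d * y ^ 2) * (Q f + d * x ^ 2))
        (b := Q e * Q f + d * (Q e * x ^ 2 + x * y + Q f * y ^ 2)) (d * x * y) (by
          linear_combination (-d * x * y) * CharTwo.two_eq_zero (R := K))
      rw [key, mul_add d, QuotientAddGroup.mk_add, QuotientAddGroup.mk_add]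
      abel

theorem IsArfAt.symm {n : ℕ} {Q : QuadraticForm K V} {e f : V} {a : K ⧸ frakH K}
    (h : IsArfAt n Q e f a) : IsArfAt n Q f e a := by
  obtain ⟨hef, c, hc, rfl⟩ := h
  refine ⟨by rw [polar_comm, hef], c, ?_, by rw [mul_comm]⟩
  rw [planeComplement_comm]
  exact hc

theorem IsArfAt.smul {n : ℕ} {Q : QuadraticForm K V} {e f : V} {a : K ⧸ frakH K}
    (h : IsArfAt n Q e f a) {t : K} (ht : t ≠ 0) : IsArfAt n Q (t • e) (t⁻¹ • f) a := by
  obtain ⟨hef, c, hc, rfl⟩ := h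
  refine ⟨?_, c, ?_, ?_⟩
  · rw [polar_smul_left, polar_smul_right, hef]
    simp [ht]
  · rw [planeComplement_smul Q e f ht (inv_ne_zero ht)]
    exact hc
  · rw [QuadraticMap.map_smul, QuadraticMap.map_smul]
    congr 2
    simp only [smul_eq_mul]
    field_simp

/-- The complements of two planes that share the vector `e`. -/
def planeComplementTwist (Q : QuadraticForm K V) {e f f' : V} (h : polar Q e f = 1)
    (h' : polar Q e f' = 1) : planeComplement Q e f ≃ₗ[K] planeComplement Q e f' where
  toFun x := ⟨x + polar Q f' x • e, by
    have hx := mem_planeComplement.1 x.2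
    rw [mem_planeComplement]
    simp [polar_add_right, polar_smul_right, polar_comm Q f' e, h', hx.1, CharTwo.two_eq_zero,
      CharTwo.add_self_eq_zero]⟩
  map_add' x y := by
    ext; simp [polar_add_right]; module
  map_smul' c x := by
    ext; simp [polar_smul_right, mul_smul]
  invFun x := ⟨x + polar Q f x • e, by
    have hx := mem_planeComplement.1 x.2
    rw [mem_planeComplement]
    simp [polar_add_right, polar_smul_right, polar_comm Q f e, h, hx.1, CharTwo.two_eq_zero,
      CharTwo.add_self_eq_zero]⟩
  left_inv x := by
    have hx := mem_planeComplement.1 x.2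
    ext
    simp [polar_add_right, polar_smul_right, polar_comm Q f e, h, hx.2, add_assoc, ← add_smul,
      CharTwo.add_self_eq_zero]
  right_inv x := by
    have hx := mem_planeComplement.1 x.2
    ext
    simp [polar_add_right, polar_smul_right, polar_comm Q f' e, h', hx.2, add_assoc, ← add_smul,
      CharTwo.add_self_eq_zero]

/-- Write `f' = t e + f + w`. The map `x ↦ x + B(f', x) e` between the complements turns `Q` into
its twist by `Q(e)` and `w`, so the class of the complement shifts by `Q(e) Q(w)`. So does that of
`Q(e) Q(f')` relative to `Q(e) Q(f)`. -/
theorem IsArfAt.change_right {n : ℕ} {Q : QuadraticForm K V} {e f f' : V} {a : K ⧸ frakH K}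
    (h : IsArfAt n Q e f a) (hf' : polar Q e f' = 1) : IsArfAt n Q e f' a := by
  obtain ⟨hef, c, hc, rfl⟩ := h
  obtain ⟨t, s, w, hw, rfl⟩ := exists_eq_smul_add_smul_add Q hef f'
  have hs : s = 1 := by
    have hw' := mem_planeComplement.1 hw
    simpa [polar_add_right, polar_smul_right, hef, hw'.1, CharTwo.two_eq_zero] using hf'
  subst hs
  have hiso :
      (CharTwoGeometry.twist (Q.restrict (planeComplement Q e f)) (Q e) ⟨w, hw⟩).IsometryEquiv
      (Q.restrict (planeComplement Q e (t • e + (1 : K) • f + w))) :=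
    { toLinearEquiv := planeComplementTwist Q hef hf'
      map_app' := fun x => by
        have hx := mem_planeComplement.1 x.2
        have h1 : polar Q (t • e + (1 : K) • f + w) x = polar Q w x := by
          simp [polar_add_left, polar_smul_left, hx.1, hx.2]
        change Q (x + polar Q (t • e + (1 : K) • f + w) x • e) = _
        rw [twist_apply, h1, QuadraticMap.map_add Q, polar_smul_right, polar_comm Q x e, hx.1,
          QuadraticMap.map_smul, smul_zero, add_zero, restrict_apply, smul_eq_mul]
        change _ = Q x + Q e * polar Q w x ^ 2
        ring }
  refine ⟨hf', _, (hc.twist (Q e) ⟨w, hw⟩).of_isometryEquiv hiso, ?_⟩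
  rw [map_smul_add_smul_add Q hef hw, restrict_apply]
  -- The terms with `t` form the element `Q(e) t + (Q(e) t)²` of `𝔥(K)`.
  have key := mk_eq_mk_of_eq_add (a := Q e * (Q e * t ^ 2 + t * 1 + Q f * 1 ^ 2 + Q w))
    (b := Q e * Q f + Q e * Q w) (Q e * t) (by ring)
  have h2 : ((Q e * Q w : K) : K ⧸ frakH K) + ((Q e * Q w : K) : K ⧸ frakH K) = 0 := by
    rw [← QuotientAddGroup.mk_add, CharTwo.add_self_eq_zero]; rfl
  rw [key, QuotientAddGroup.mk_add, add_add_add_comm]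
  change _ = _ + (((Q e * Q w : K) : K ⧸ frakH K) + ((Q e * Q w : K) : K ⧸ frakH K))
  rw [h2, add_zero]

theorem IsArfAt.change {n : ℕ} {Q : QuadraticForm K V} {e f e' f' : V} {a : K ⧸ frakH K}
    (h : IsArfAt n Q e f a) (h' : polar Q e' f' = 1) : IsArfAt n Q e' f' a := by
  -- The chain of pairs is `(e, f)`, `(e, g)`, `(g, e')`, `(e', f')` up to scalars; neighbours share
  -- a vector.
  obtain ⟨g, hg, hg'⟩ := exists_polar_ne_zero_and (Q := Q) (e := e) (f := f) (e' := e') (f' := f')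
    (by rw [h.1]; exact one_ne_zero) (by rw [h']; exact one_ne_zero)
  have h1 : IsArfAt n Q e ((polar Q e g)⁻¹ • g) a :=
    h.change_right (by rw [polar_smul_right, smul_eq_mul, inv_mul_cancel₀ hg])
  have h2 := (h1.symm.smul hg).change_right (f' := (polar Q e' g)⁻¹ • e') (by
    rw [smul_inv_smul₀ hg, polar_smul_right, polar_comm Q g, smul_eq_mul, inv_mul_cancel₀ hg'])
  have h3 := h2.symm.smul hg'
  rw [smul_inv_smul₀ hg'] at h3
  exact h3.change_right h'

theorem IsArf.unique {n : ℕ} {Q : QuadraticForm K V} {a b : K ⧸ frakH K} (ha : IsArf n Q a)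
    (hb : IsArf n Q b) : a = b := by
  induction n generalizing V a b with
  | zero => rw [ha.2, hb.2]
  | succ n ih =>
    obtain ⟨e, f, h⟩ := isArf_succ.1 ha
    obtain ⟨e', f', h', c, hc, rfl⟩ := hb
    obtain ⟨_, d, hd, rfl⟩ := h.change h'
    rw [ih hc hd]

/-- The Arf value of the complement of a plane. -/
theorem IsArf.exists_planeComplement {n : ℕ} {Q : QuadraticForm K V} {a : K ⧸ frakH K}
    (h : IsArf (n + 1) Q a) {e f : V} (hef : polar Q e f = 1) :
    IsArf n (Q.restrict (planeComplement Q e f)) (a - ((Q e * Q f : K) : K ⧸ frakH K)) := by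
  obtain ⟨e', f', h'⟩ := isArf_succ.1 h
  obtain ⟨_, c, hc, rfl⟩ := h'.change hef
  rwa [add_sub_cancel_left]

end ArfInvariant

/-! ### Comparison with `HasArf`, classification, and Witt extension of one vector. -/

section Classification

variable {K : Type*} [Field K] [CharP K 2]
variable {V : Type u} [AddCommGroup V] [Module K V]
variable {V' : Type v} [AddCommGroup V'] [Module K V']

theorem isArf_of_basis [FiniteDimensional K V] {Q : QuadraticForm K V} (k : ℕ)
    (b : Basis (Fin k × Fin 2) K V)
    (h₀ : ∀ i j, i ≠ j → ∀ s t, polar Q (b (i, s)) (b (j, t)) = 0)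
    (h₁ : ∀ i, polar Q (b (i, 0)) (b (i, 1)) ≠ 0) :
    IsArf k Q ((∑ i, Q (b (i, 0)) * Q (b (i, 1)) /
      polar Q (b (i, 0)) (b (i, 1)) ^ 2 : K) : K ⧸ frakH K) := by
  induction k generalizing V with
  | zero => exact ⟨b.repr.toEquiv.subsingleton, by simp⟩
  | succ k ih =>
    set e := b (0, 0) with he
    set r := polar Q e (b (0, 1)) with hr
    have hr0 : r ≠ 0 := h₁ 0
    set f := r⁻¹ • b (0, 1) with hf
    have hef : polar Q e f = 1 := by
      rw [hf, polar_smul_right, smul_eq_mul, ← hr, inv_mul_cancel₀ hr0]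
    let c : Fin k × Fin 2 → planeComplement Q e f := fun i =>
      ⟨b (i.1.succ, i.2), mem_planeComplement.2 ⟨h₀ _ _ (Fin.succ_ne_zero _).symm _ _, by
        rw [hf, polar_smul_left, h₀ _ _ (Fin.succ_ne_zero _).symm, smul_zero]⟩⟩
    have hc : LinearIndependent K c := by
      refine LinearIndependent.of_comp (planeComplement Q e f).subtype ?_
      refine b.linearIndependent.comp (fun i : Fin k × Fin 2 => (i.1.succ, i.2)) ?_
      rintro ⟨i, s⟩ ⟨j, t⟩ hij
      simpa using hij
    have hcard : Fintype.card (Fin k × Fin 2) = finrank K (planeComplement Q e f) := by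
      have h1 := finrank_planeComplement Q hef
      rw [finrank_eq_card_basis b] at h1
      simp only [Fintype.card_prod, Fintype.card_fin] at h1 ⊢
      omega
    have hc' := ih (Q := Q.restrict (planeComplement Q e f))
      (Basis.mk hc (hc.span_eq_top_of_card_eq_finrank' hcard).ge)
      (fun i j hij s t => by
        rw [Basis.mk_apply, Basis.mk_apply]
        exact h₀ _ _ (fun h => hij (Fin.succ_injective _ h)) _ _)
      (fun i => by
        rw [Basis.mk_apply, Basis.mk_apply]
        exact h₁ _)
    refine ⟨e, f, hef, _, hc', ?_⟩
    rw [← QuotientAddGroup.mk_add, Fin.sum_univ_succ]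
    congr 2
    · rw [hf, QuadraticMap.map_smul, smul_eq_mul, ← hr]
      field_simp
      exact mul_comm _ _
    · refine Finset.sum_congr rfl fun i _ => ?_
      rw [Basis.mk_apply, Basis.mk_apply]
      rfl

theorem HasArf.exists_isArf [FiniteDimensional K V] {Q : QuadraticForm K V} {a : K ⧸ frakH K}
    (h : HasArf Q a) : ∃ n, IsArf n Q a := by
  obtain ⟨k, b, h₀, h₁, rfl⟩ := h
  exact ⟨k, isArf_of_basis k b h₀ h₁⟩

theorem IsArf.hasArf {n : ℕ} {Q : QuadraticForm K V} {a : K ⧸ frakH K} (h : IsArf n Q a) :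
    HasArf Q a := by
  induction n generalizing V a with
  | zero =>
    obtain ⟨hV, rfl⟩ := h
    exact ⟨0, Basis.empty V, fun i => i.elim0, fun i => i.elim0, by simp⟩
  | succ n ih =>
    obtain ⟨e, f, hef, _, hc, rfl⟩ := h
    obtain ⟨k, c, h₀, h₁, rfl⟩ := ih hc
    let σ : Fin 2 ⊕ Fin k × Fin 2 ≃ Fin (k + 1) × Fin 2 :=
      { toFun := Sum.elim (fun s => (0, s)) (fun i => (i.1.succ, i.2))
        invFun := fun i => Fin.cases (motive := fun _ => Fin 2 ⊕ Fin k × Fin 2)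
          (Sum.inl i.2) (fun j => Sum.inr (j, i.2)) i.1
        left_inv := by rintro (s | ⟨i, s⟩) <;> simp
        right_inv := by
          rintro ⟨i, s⟩
          refine Fin.cases ?_ (fun j => ?_) i <;> simp }
    let b : Basis (Fin (k + 1) × Fin 2) K V :=
      (((Basis.finTwoProd K).prod c).map (splitEquiv Q hef).symm).reindex σ
    have b0 : b (0, 0) = e := by
      simp [b, σ, splitEquiv]
    have b1 : b (0, 1) = f := by
      simp [b, σ, splitEquiv]
    have bs : ∀ (i : Fin k) (s : Fin 2), b (i.succ, s) = c (i, s) := by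
      intro i s
      simp [b, σ, splitEquiv]
    have hperp : ∀ (s : Fin 2) (i : Fin k) (t : Fin 2),
        polar Q (b (0, s)) (b (i.succ, t)) = 0 := by
      intro s i t
      have := mem_planeComplement.1 (c (i, t)).2
      rw [bs]
      match s with
      | 0 => rw [b0]; exact this.1
      | 1 => rw [b1]; exact this.2
    refine ⟨k + 1, b, ?_, ?_, ?_⟩
    · intro i j
      cases i using Fin.cases <;> cases j using Fin.cases
      · exact fun h => absurd rfl h
      · exact fun _ s t => hperp s _ t
      · intro _ s t
        rw [polar_comm]
        exact hperp t _ s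
      · intro hij s t
        rw [bs, bs]
        exact h₀ _ _ (fun h => hij (congrArg Fin.succ h)) s t
    · intro i
      cases i using Fin.cases
      · rw [b0, b1, hef]
        exact one_ne_zero
      · rw [bs, bs]
        exact h₁ _
    · rw [Fin.sum_univ_succ, b0, b1, hef, one_pow, div_one, QuotientAddGroup.mk_add]
      simp only [bs]
      rfl

theorem HasArf.of_isometryEquiv {Q : QuadraticForm K V} {Q' : QuadraticForm K V'}
    {a : K ⧸ frakH K} (h : HasArf Q a) (φ : Q.IsometryEquiv Q') : HasArf Q' a := by
  obtain ⟨k, b, h₀, h₁, rfl⟩ := h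
  have hb : ∀ i, b.map φ.toLinearEquiv i = φ (b i) := fun i => b.map_apply _ i
  refine ⟨k, b.map φ.toLinearEquiv, fun i j hij s t => ?_, fun i => ?_, ?_⟩
  · rw [hb, hb, polar_isometryEquiv, h₀ i j hij]
  · rw [hb, hb, polar_isometryEquiv]
    exact h₁ i
  · simp only [hb, polar_isometryEquiv, φ.map_app]

/-- Some vector is non-singular because `B` is not zero, and scaling it multiplies its value by an
arbitrary square, that is, by an arbitrary scalar. -/
theorem IsArf.exists_apply_eq [PerfectField K] {n : ℕ} {Q : QuadraticForm K V} {a : K ⧸ frakH K}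
    (h : IsArf (n + 1) Q a) (c : K) : ∃ w, Q w = c := by
  obtain ⟨e, f, hef, -⟩ := isArf_succ.1 h
  have : ∃ x, Q x ≠ 0 := by
    by_contra! h0
    rw [polar, h0, h0, h0] at hef
    simp at hef
  obtain ⟨x, hx⟩ := this
  obtain ⟨s, hs⟩ := surjective_frobenius K 2 (c / Q x)
  refine ⟨s • x, ?_⟩
  rw [frobenius_def, pow_two] at hs
  rw [QuadraticMap.map_smul, hs, smul_eq_mul, div_mul_cancel₀ _ hx]

theorem polar_add_smul_self (Q : QuadraticForm K V) (u v : V) (t : K) :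
    polar Q u (v + t • u) = polar Q u v := by
  simp [polar_add_right, polar_smul_right, CharTwo.two_eq_zero]

/-- The only place where equality of the Arf classes produces equal values of `Q`, and only for a
plane: there `Q(u)` and the class determine `Q(v)` up to replacing `v` by `v + t u`. In higher
dimension both partners can be made singular. -/
theorem IsArf.exists_partners [PerfectField K] {n : ℕ} {Q : QuadraticForm K V}
    {Q' : QuadraticForm K V'} {a : K ⧸ frakH K} (h : IsArf (n + 1) Q a)
    (h' : IsArf (n + 1) Q' a) {u : V} {u' : V'} (hu : u ≠ 0) (hu' : u' ≠ 0) (huu' : Q u = Q' u') :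
    ∃ v v', polar Q u v = 1 ∧ polar Q' u' v' = 1 ∧ Q v = Q' v' := by
  obtain ⟨v, hv⟩ := exists_polar_eq_one h.nondegenerate hu
  obtain ⟨v', hv'⟩ := exists_polar_eq_one h'.nondegenerate hu'
  have hc := h.exists_planeComplement hv
  have hc' := h'.exists_planeComplement hv'
  cases n with
  | zero =>
    by_cases h0 : Q u = 0
    · refine ⟨v + Q v • u, v' + Q' v' • u', ?_, ?_, ?_⟩
      · rw [polar_add_smul_self, hv]
      · rw [polar_add_smul_self, hv']
      · rw [map_add_smul_of_polar_eq_one hv, map_add_smul_of_polar_eq_one hv', ← huu', h0]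
        simp [CharTwo.add_self_eq_zero]
    -- The products `Q(u) Q(v)` and `Q'(u') Q'(v')` differ by some `t + t²`; adding `(t / Q(u)) u'`
    -- to `v'` absorbs this difference.
    · obtain ⟨t, ht⟩ := exists_of_mk_eq_mk ((sub_eq_zero.1 hc.2).symm.trans (sub_eq_zero.1 hc'.2))
      refine ⟨v, v' + (t / Q u) • u', hv, ?_, ?_⟩
      · rw [polar_add_smul_self, hv']
      · rw [map_add_smul_of_polar_eq_one hv']
        rw [← huu'] at ht ⊢
        field_simp
        linear_combination ht
  | succ m =>
    -- A vector `w` of the complement with `Q(w) = Q(v)` makes `v + w` singular without changing its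
    -- pairing with `u`.
    obtain ⟨⟨w, hw⟩, hwv⟩ := hc.exists_apply_eq (Q v)
    obtain ⟨⟨w', hw'⟩, hwv'⟩ := hc'.exists_apply_eq (Q' v')
    rw [mem_planeComplement] at hw hw'
    rw [restrict_apply] at hwv hwv'
    refine ⟨v + w, v' + w', ?_, ?_, ?_⟩
    · rw [polar_add_right, hv, hw.1, add_zero]
    · rw [polar_add_right, hv', hw'.1, add_zero]
    · simp only at hwv hwv'
      rw [QuadraticMap.map_add Q, QuadraticMap.map_add Q', hw.2, hw'.2, hwv, hwv',
        CharTwo.add_self_eq_zero, CharTwo.add_self_eq_zero (Q' v')]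

/-- Over a perfect field, dimension and Arf value classify non-degenerate quadratic forms. -/
theorem IsArf.nonempty_isometryEquiv [PerfectField K] {n : ℕ} {Q : QuadraticForm K V}
    {Q' : QuadraticForm K V'} {a : K ⧸ frakH K} (h : IsArf n Q a) (h' : IsArf n Q' a) :
    Nonempty (Q.IsometryEquiv Q') := by
  induction n generalizing V V' a with
  | zero =>
    have := h.1
    have := h'.1
    exact ⟨{ toLinearEquiv := 0
             map_app' := fun x => by
              rw [Subsingleton.elim x 0]
              simp }⟩
  | succ n ih =>
    -- The value one serves only to give non-zero vectors with a common value.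
    obtain ⟨u, hu⟩ := h.exists_apply_eq 1
    obtain ⟨u', hu'⟩ := h'.exists_apply_eq 1
    have hu0 : u ≠ 0 := by rintro rfl; simp at hu
    have hu0' : u' ≠ 0 := by rintro rfl; simp at hu'
    obtain ⟨v, v', hv, hv', hvv'⟩ := h.exists_partners h' hu0 hu0' (hu.trans hu'.symm)
    have hc := h.exists_planeComplement hv
    have hc' := h'.exists_planeComplement hv'
    rw [← hu.trans hu'.symm, ← hvv'] at hc'
    obtain ⟨φ⟩ := ih hc hc'
    obtain ⟨ψ, -⟩ := exists_isometryEquiv_of_planeComplement hv hv' (hu.trans hu'.symm) hvv' φ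
    exact ⟨ψ⟩

/-- A form of Witt's theorem for one vector. -/
theorem IsArf.exists_isometryEquiv_apply_eq [PerfectField K] {n : ℕ} {Q : QuadraticForm K V}
    {Q' : QuadraticForm K V'} {a : K ⧸ frakH K} (h : IsArf n Q a) (h' : IsArf n Q' a)
    {u : V} {u' : V'} (hu : u ≠ 0) (hu' : u' ≠ 0) (huu' : Q u = Q' u') :
    ∃ φ : Q.IsometryEquiv Q', φ u = u' := by
  cases n with
  | zero =>
    have := h.1
    exact absurd (Subsingleton.elim u 0) hu
  | succ n =>
    obtain ⟨v, v', hv, hv', hvv'⟩ := h.exists_partners h' hu hu' huu'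
    have hc := h.exists_planeComplement hv
    have hc' := h'.exists_planeComplement hv'
    rw [← huu', ← hvv'] at hc'
    obtain ⟨φ⟩ := hc.nonempty_isometryEquiv hc'
    obtain ⟨ψ, hψ, -⟩ := exists_isometryEquiv_of_planeComplement hv hv' huu' hvv' φ
    exact ⟨ψ, hψ⟩

end Classification

/-! ### Witt extension for pairs and triples of vectors. -/

section Triples

variable {K : Type*} [Field K]
variable {V : Type u} [AddCommGroup V] [Module K V]
variable {V' : Type v} [AddCommGroup V'] [Module K V']

/-- Non-degeneracy identifies `V` with its dual, so a coordinate functional of the independent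
family, extended to `V`, is represented by a vector. -/
theorem exists_polar_eq_pi_single [FiniteDimensional K V] {Q : QuadraticForm K V}
    (hQ : Q.polarBilin.Nondegenerate) {ι : Type*} [DecidableEq ι] {x : ι → V}
    (hx : LinearIndependent K x) (i : ι) :
    ∃ f, ∀ j, polar Q (x j) f = Pi.single (M := fun _ => K) i 1 j := by
  obtain ⟨g, hg⟩ := LinearMap.exists_leftInverse_of_injective _ (LinearMap.ker_eq_bot.2 hx)
  have hsurj : Function.Surjective Q.polarBilin := by
    refine (LinearMap.injective_iff_surjective_of_finrank_eq_finrank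
      Subspace.dual_finrank_eq.symm).1 (LinearMap.ker_eq_bot.1 ?_)
    refine (Submodule.eq_bot_iff _).2 fun y hy => nondegenerate_iff.1 hQ y fun z => ?_
    exact LinearMap.congr_fun hy z
  obtain ⟨f, hf⟩ := hsurj ((Finsupp.lapply i).comp g)
  refine ⟨f, fun j => ?_⟩
  have h1 : polar Q f (x j) = g (x j) i := LinearMap.congr_fun hf (x j)
  have h2 : g (x j) = Finsupp.single j 1 := by
    have := LinearMap.congr_fun hg (Finsupp.single j 1)
    simpa using this
  rw [polar_comm, h1, h2, Finsupp.single_apply, Pi.single_apply]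

theorem add_smul_ne_zero {x y z : V} (h : LinearIndependent K ![x, y, z]) (t : K) :
    z + t • y ≠ 0 := by
  intro h0
  have := Fintype.linearIndependent_iff.1 h ![0, t, 1] (by
    simp [Fin.sum_univ_three, add_comm _ z, h0]) 2
  simp at this

variable [CharP K 2]

/-- Adding `Q(f) x_i` to a dual vector `f` makes it singular, and keeps its pairings because `x_i`
is orthogonal to the whole family. The remaining vectors then lie in the complement of the plane of
`x_i` and `f`. -/
theorem exists_hyperbolic_partner [FiniteDimensional K V] {Q : QuadraticForm K V}
    (hQ : Q.polarBilin.Nondegenerate) {ι : Type*} [DecidableEq ι] {x : ι → V}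
    (hx : LinearIndependent K x) (i : ι) (hi : Q (x i) = 0) (hij : ∀ j, polar Q (x j) (x i) = 0) :
    ∃ f, Q f = 0 ∧ ∀ j, polar Q (x j) f = Pi.single (M := fun _ => K) i 1 j := by
  obtain ⟨f, hf⟩ := exists_polar_eq_pi_single hQ hx i
  have h1 := hf i
  rw [Pi.single_eq_same] at h1
  refine ⟨f + Q f • x i, ?_, fun j => ?_⟩
  · rw [map_add_smul_of_polar_eq_one h1, hi, mul_zero, add_zero, CharTwo.add_self_eq_zero]
  · rw [polar_add_right, polar_smul_right, hij, smul_zero, add_zero, hf]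

/-- A form of Witt's theorem for two orthogonal vectors, one of which is singular. -/
theorem IsArf.exists_isometryEquiv_apply_eq_pair [PerfectField K] [FiniteDimensional K V]
    [FiniteDimensional K V'] {n : ℕ} {Q : QuadraticForm K V} {Q' : QuadraticForm K V'}
    {a : K ⧸ frakH K} (h : IsArf n Q a) (h' : IsArf n Q' a) {x y : V} {x' y' : V'}
    (hxy : LinearIndependent K ![x, y]) (hxy' : LinearIndependent K ![x', y'])
    (hx : Q x = 0) (hx' : Q' x' = 0) (hyy' : Q y = Q' y')
    (hyx : polar Q y x = 0) (hyx' : polar Q' y' x' = 0) :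
    ∃ φ : Q.IsometryEquiv Q', φ x = x' ∧ φ y = y' := by
  cases n with
  | zero =>
    have := h.1
    exact absurd (Subsingleton.elim x 0) (hxy.ne_zero 0)
  | succ n =>
    obtain ⟨f, hf, hxf⟩ := exists_hyperbolic_partner h.nondegenerate hxy 0 hx
      (Fin.forall_fin_two.2 ⟨polar_self_eq_zero Q x, hyx⟩)
    obtain ⟨f', hf', hxf'⟩ := exists_hyperbolic_partner h'.nondegenerate hxy' 0 hx'
      (Fin.forall_fin_two.2 ⟨polar_self_eq_zero Q' x', hyx'⟩)
    have h1 : polar Q x f = 1 := by simpa using hxf 0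
    have h1' : polar Q' x' f' = 1 := by simpa using hxf' 0
    have h2 : polar Q y f = 0 := by simpa using hxf 1
    have h2' : polar Q' y' f' = 0 := by simpa using hxf' 1
    have hc := h.exists_planeComplement h1
    have hc' := h'.exists_planeComplement h1'
    rw [hx, zero_mul] at hc
    rw [hx', zero_mul] at hc'
    have hy : y ∈ planeComplement Q x f :=
      mem_planeComplement.2 ⟨by rw [polar_comm, hyx], by rw [polar_comm, h2]⟩
    have hy' : y' ∈ planeComplement Q' x' f' :=
      mem_planeComplement.2 ⟨by rw [polar_comm, hyx'], by rw [polar_comm, h2']⟩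
    obtain ⟨φ, hφ⟩ := hc.exists_isometryEquiv_apply_eq hc' (u := ⟨y, hy⟩) (u' := ⟨y', hy'⟩)
      (fun h0 => hxy.ne_zero 1 (congrArg Subtype.val h0))
      (fun h0 => hxy'.ne_zero 1 (congrArg Subtype.val h0)) hyy'
    obtain ⟨ψ, hψ, -, hψφ⟩ := exists_isometryEquiv_of_planeComplement h1 h1' (hx.trans hx'.symm)
      (hf.trans hf'.symm) φ
    exact ⟨ψ, hψ, by rw [hψφ ⟨y, hy⟩, hφ]⟩

/-- A form of Witt's theorem for three mutually orthogonal vectors, two of which are singular. -/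
theorem IsArf.exists_isometryEquiv_apply_eq_triple [PerfectField K] [FiniteDimensional K V]
    [FiniteDimensional K V'] {n : ℕ} {Q : QuadraticForm K V} {Q' : QuadraticForm K V'}
    {a : K ⧸ frakH K} (h : IsArf n Q a) (h' : IsArf n Q' a) {x y z : V} {x' y' z' : V'}
    (hxyz : LinearIndependent K ![x, y, z]) (hxyz' : LinearIndependent K ![x', y', z'])
    (hx : Q x = 0) (hx' : Q' x' = 0) (hy : Q y = 0) (hy' : Q' y' = 0) (hzz' : Q z = Q' z')
    (hyx : polar Q y x = 0) (hyx' : polar Q' y' x' = 0)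
    (hzx : polar Q z x = 0) (hzx' : polar Q' z' x' = 0)
    (hzy : polar Q z y = 0) (hzy' : polar Q' z' y' = 0) :
    ∃ φ : Q.IsometryEquiv Q', φ x = x' ∧ φ y = y' ∧ φ z = z' := by
  cases n with
  | zero =>
    have := h.1
    exact absurd (Subsingleton.elim x 0) (hxyz.ne_zero 0)
  | succ n =>
    obtain ⟨f, hf, hxf⟩ := exists_hyperbolic_partner h.nondegenerate hxyz 0 hx
      (Fin.forall_fin_succ.2 ⟨polar_self_eq_zero Q x, Fin.forall_fin_two.2 ⟨hyx, hzx⟩⟩)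
    obtain ⟨f', hf', hxf'⟩ := exists_hyperbolic_partner h'.nondegenerate hxyz' 0 hx'
      (Fin.forall_fin_succ.2 ⟨polar_self_eq_zero Q' x', Fin.forall_fin_two.2 ⟨hyx', hzx'⟩⟩)
    have h1 : polar Q x f = 1 := by simpa using hxf 0
    have h1' : polar Q' x' f' = 1 := by simpa using hxf' 0
    have h2 : polar Q y f = 0 := by simpa using hxf 1
    have h2' : polar Q' y' f' = 0 := by simpa using hxf' 1
    have h3 : polar Q z f = 0 := by simpa using hxf 2
    have h3' : polar Q' z' f' = 0 := by simpa using hxf' 2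
    have hc := h.exists_planeComplement h1
    have hc' := h'.exists_planeComplement h1'
    rw [hx, zero_mul] at hc
    rw [hx', zero_mul] at hc'
    have my : y ∈ planeComplement Q x f :=
      mem_planeComplement.2 ⟨by rw [polar_comm, hyx], by rw [polar_comm, h2]⟩
    have my' : y' ∈ planeComplement Q' x' f' :=
      mem_planeComplement.2 ⟨by rw [polar_comm, hyx'], by rw [polar_comm, h2']⟩
    have mz : z ∈ planeComplement Q x f :=
      mem_planeComplement.2 ⟨by rw [polar_comm, hzx], by rw [polar_comm, h3]⟩
    have mz' : z' ∈ planeComplement Q' x' f' :=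
      mem_planeComplement.2 ⟨by rw [polar_comm, hzx'], by rw [polar_comm, h3']⟩
    obtain ⟨φ, hφy, hφz⟩ := hc.exists_isometryEquiv_apply_eq_pair hc'
      (x := ⟨y, my⟩) (y := ⟨z, mz⟩) (x' := ⟨y', my'⟩) (y' := ⟨z', mz'⟩)
      (.of_comp (Submodule.subtype _) (by
        convert hxyz.comp Fin.succ (Fin.succ_injective 2) using 1
        ext i; fin_cases i <;> rfl))
      (.of_comp (Submodule.subtype _) (by
        convert hxyz'.comp Fin.succ (Fin.succ_injective 2) using 1
        ext i; fin_cases i <;> rfl)) hy hy' hzz' hzy hzy'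
    obtain ⟨ψ, hψ, -, hψφ⟩ := exists_isometryEquiv_of_planeComplement h1 h1' (hx.trans hx'.symm)
      (hf.trans hf'.symm) φ
    exact ⟨ψ, hψ, by rw [hψφ ⟨y, my⟩, hφy], by rw [hψφ ⟨z, mz⟩, hφz]⟩

/-- A form of Witt's theorem for a non-degenerate plane and a vector. -/
theorem IsArf.exists_isometryEquiv_apply_eq_plane [PerfectField K] {n : ℕ}
    {Q : QuadraticForm K V} {Q' : QuadraticForm K V'} {a : K ⧸ frakH K} (h : IsArf n Q a)
    (h' : IsArf n Q' a) {e f g : V} {e' f' g' : V'}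
    (hefg : LinearIndependent K ![e, f, g]) (hefg' : LinearIndependent K ![e', f', g'])
    (hef : polar Q e f = 1) (hef' : polar Q' e' f' = 1) (hfg : polar Q f g = 0)
    (hfg' : polar Q' f' g' = 0) (heg : polar Q e g = polar Q' e' g')
    (hee' : Q e = Q' e') (hff' : Q f = Q' f') (hgg' : Q g = Q' g') :
    ∃ φ : Q.IsometryEquiv Q', φ e = e' ∧ φ f = f' ∧ φ g = g' := by
  cases n with
  | zero =>
    have := h.1
    exact absurd (Subsingleton.elim e 0) (hefg.ne_zero 0)
  | succ n =>
    have hc := h.exists_planeComplement hef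
    have hc' := h'.exists_planeComplement hef'
    rw [← hee', ← hff'] at hc'
    set t := polar Q e g with ht
    -- This is the component of `g` in the complement, since `B(f, g) = 0`. It is non-zero by
    -- independence, and Witt extension for one vector applies to it.
    have mu : g + t • f ∈ planeComplement Q e f := mem_planeComplement.2 (by
      simp [polar_add_right, polar_smul_right, hef, hfg, ← ht, CharTwo.two_eq_zero,
        CharTwo.add_self_eq_zero])
    have mu' : g' + t • f' ∈ planeComplement Q' e' f' := mem_planeComplement.2 (by
      simp [polar_add_right, polar_smul_right, hef', hfg', ← heg, CharTwo.two_eq_zero,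
        CharTwo.add_self_eq_zero])
    obtain ⟨φ, hφ⟩ := hc.exists_isometryEquiv_apply_eq hc' (u := ⟨_, mu⟩) (u' := ⟨_, mu'⟩)
      (fun h0 => add_smul_ne_zero hefg t (congrArg Subtype.val h0))
      (fun h0 => add_smul_ne_zero hefg' t (congrArg Subtype.val h0)) (by
        change Q (g + t • f) = Q' (g' + t • f')
        rw [QuadraticMap.map_add Q, QuadraticMap.map_add Q', QuadraticMap.map_smul,
          QuadraticMap.map_smul, polar_smul_right, polar_smul_right, polar_comm Q g,
          polar_comm Q' g', hfg, hfg', hff', hgg'])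
    obtain ⟨ψ, hψe, hψf, hψ⟩ := exists_isometryEquiv_of_planeComplement hef hef' hee' hff' φ
    refine ⟨ψ, hψe, hψf, ?_⟩
    have := hψ ⟨_, mu⟩
    rw [hφ] at this
    simp only [map_add, map_smul, hψf] at this
    exact add_right_cancel this

end Triples

/-! ### Projective points and normalized representatives. -/

section Points

variable {K : Type w} [Field K]
variable {V : Type u} [AddCommGroup V] [Module K V]
variable {V' : Type v} [AddCommGroup V'] [Module K V']

theorem independent_mk_iff {x y z : V} (hx : x ≠ 0) (hy : y ≠ 0) (hz : z ≠ 0) :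
    Projectivization.Independent ![Projectivization.mk K x hx, Projectivization.mk K y hy,
      Projectivization.mk K z hz] ↔ LinearIndependent K ![x, y, z] := by
  obtain ⟨a, ha⟩ := Projectivization.exists_smul_eq_mk_rep K x hx
  obtain ⟨b, hb⟩ := Projectivization.exists_smul_eq_mk_rep K y hy
  obtain ⟨c, hc⟩ := Projectivization.exists_smul_eq_mk_rep K z hz
  have h : Projectivization.rep ∘ ![Projectivization.mk K x hx, Projectivization.mk K y hy,
      Projectivization.mk K z hz] = ![a, b, c] • ![x, y, z] := by
    funext i
    fin_cases i
    · exact ha.symm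
    · exact hb.symm
    · exact hc.symm
  rw [Projectivization.independent_iff, h, LinearIndependent.units_smul_iff]

theorem arfPair_eq_infty_iff {Q : QuadraticForm K V} {x y : V} :
    arfPair Q x y = ∞ ↔ polar Q x y = 0 := by
  unfold arfPair
  split_ifs with h <;> simp [h]

theorem arfPair_of_polar_eq_one {Q : QuadraticForm K V} {x y : V} (h : polar Q x y = 1) :
    arfPair Q x y = ((Q x * Q y : K) : OnePoint K) := by
  unfold arfPair
  rw [if_neg (by rw [h]; exact one_ne_zero), h, one_pow, div_one]

theorem map_rep_ne_zero_iff (Q : QuadraticForm K V) {x : V} (hx : x ≠ 0) :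
    Q (Projectivization.mk K x hx).rep ≠ 0 ↔ Q x ≠ 0 := by
  obtain ⟨a, ha⟩ := Projectivization.exists_smul_eq_mk_rep K x hx
  rw [← ha, Units.smul_def, QuadraticMap.map_smul]
  simp

theorem arfPoints_map {Q : QuadraticForm K V} {Q' : QuadraticForm K V'}
    (φ : Q.IsometryEquiv Q') (p q : ℙ K V) :
    arfPoints Q' (Projectivization.map φ.toLinearEquiv.toLinearMap φ.toLinearEquiv.injective p)
      (Projectivization.map φ.toLinearEquiv.toLinearMap φ.toLinearEquiv.injective q) =
      arfPoints Q p q := by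
  induction p using Projectivization.ind with | _ x hx
  induction q using Projectivization.ind with | _ y hy
  rw [Projectivization.map_mk, Projectivization.map_mk, arfPoints_mk, arfPoints_mk]
  change arfPair Q' (φ x) (φ y) = _
  unfold arfPair
  rw [polar_isometryEquiv, φ.map_app, φ.map_app]

theorem mk_smul {c : K} (hc : c ≠ 0) {x : V} (hx : x ≠ 0) :
    Projectivization.mk K (c • x) (smul_ne_zero hc hx) = Projectivization.mk K x hx :=
  (Projectivization.mk_eq_mk_iff' K _ _ _ _).2 ⟨c, rfl⟩

theorem Geometry.three_le_finrank [FiniteDimensional K V] (G : Geometry K V) :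
    3 ≤ finrank K V := by
  simpa using ((Projectivization.independent_iff.1 G.independent)).fintype_card_le_finrank

theorem linearIndependent_add_add {x y z : V} (h : LinearIndependent K ![x, y, z]) :
    LinearIndependent K ![y + x, z + x, x] := by
  rw [Fintype.linearIndependent_iff] at h ⊢
  intro g hg
  have h1 := h ![g 0 + g 1 + g 2, g 0, g 1] (by
    rw [← hg]
    simp [Fin.sum_univ_three]
    module)
  have h2 := h1 0
  have h3 := h1 1
  have h4 := h1 2
  simp at h2 h3 h4
  rw [Fin.forall_fin_succ, Fin.forall_fin_two]
  refine ⟨h3, h4, ?_⟩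
  simpa [h3, h4] using h2

/-- Here `b` stands for `B(Ω, p)` and `q` for `Q(p)` at a normalized representative of `p = P` or `p
= L`; the Arf value fixes both. -/
theorem eq_and_eq_of_normalized {α α' : OnePoint K} (h : α = α') {b b' q q' : K}
    (hb : α = ∞ ∧ b = 0 ∧ q = 1 ∨ α = (q : OnePoint K) ∧ b = 1)
    (hb' : α' = ∞ ∧ b' = 0 ∧ q' = 1 ∨ α' = (q' : OnePoint K) ∧ b' = 1) :
    b = b' ∧ q = q' ∧ (b = 1 ∨ b = 0 ∧ q = 1) := by
  subst h
  rcases hb with ⟨h1, rfl, rfl⟩ | ⟨h1, rfl⟩ <;> rcases hb' with ⟨h1', rfl, rfl⟩ | ⟨h1', rfl⟩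
  · simp
  · exact absurd (h1'.symm.trans h1) (OnePoint.coe_ne_infty _)
  · exact absurd (h1.symm.trans h1') (OnePoint.coe_ne_infty _)
  · exact ⟨rfl, OnePoint.coe_injective (h1.symm.trans h1'), Or.inl rfl⟩

theorem linearIndependent_swap {x y z : V} (h : LinearIndependent K ![x, y, z]) :
    LinearIndependent K ![x, z, y] := by
  convert h.comp ![0, 2, 1] (by decide) using 1
  ext i
  fin_cases i <;> rfl

variable [CharP K 2]

/-- The radical of `B` on the hyperplane `x^⊥` is the line of `x`, which lies in its own orthogonal
in characteristic two. So the radical of the restricted form is either this line or zero, according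
to whether `x` is singular. -/
theorem radical_restrict_orthogonal_eq_bot_iff {Q : QuadraticForm K V}
    (hQ : Q.polarBilin.Nondegenerate) {x : V} (hx : x ≠ 0) :
    (Q.restrict (LinearMap.BilinForm.orthogonal Q.polarBilin
      (Projectivization.mk K x hx).submodule)).radical = ⊥ ↔ Q x ≠ 0 := by
  have hmem : ∀ y, y ∈ LinearMap.BilinForm.orthogonal Q.polarBilin
      (Projectivization.mk K x hx).submodule ↔ polar Q x y = 0 := by
    intro y
    rw [Projectivization.submodule_mk, LinearMap.BilinForm.mem_orthogonal_iff]
    constructor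
    · intro h
      exact h x (Submodule.mem_span_singleton_self x)
    · intro h z hz
      obtain ⟨c, rfl⟩ := Submodule.mem_span_singleton.1 hz
      change polar Q (c • x) y = 0
      rw [polar_smul_left, h, smul_zero]
  constructor
  · intro h h0
    have hx' : (⟨x, (hmem x).2 (polar_self_eq_zero Q x)⟩ : LinearMap.BilinForm.orthogonal
        Q.polarBilin (Projectivization.mk K x hx).submodule) ∈ (Q.restrict _).radical := by
      rw [mem_radical_iff']
      refine ⟨h0, fun y => ?_⟩
      change Q (x + y) = Q y
      rw [QuadraticMap.map_add Q, h0, (hmem y).1 y.2, add_zero, zero_add]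
    rw [h, Submodule.mem_bot] at hx'
    exact hx (congrArg Subtype.val hx')
  · intro h0
    refine (Submodule.eq_bot_iff _).2 fun ⟨v, hv⟩ hvr => ?_
    rw [mem_radical_iff'] at hvr
    obtain ⟨hv0, hvr⟩ := hvr
    change Q v = 0 at hv0
    have horth : ∀ y, polar Q x y = 0 → polar Q v y = 0 := by
      intro y hy
      have : Q (v + y) = Q y := hvr ⟨y, (hmem y).2 hy⟩
      rw [polar, this, hv0, sub_zero, sub_self]
    obtain ⟨f, hf⟩ := exists_polar_eq_one hQ hx
    have hvx : v = polar Q v f • x := by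
      refine sub_eq_zero.1 (nondegenerate_iff.1 hQ _ fun y => ?_)
      -- Subtracting `B(x, y) f` moves an arbitrary `y` into `x^⊥`, which shows that `v - B(v, f) x`
      -- is orthogonal to everything.
      have h1 := horth (y - polar Q x y • f) (by
        rw [polar_sub_right, polar_smul_right, hf, smul_eq_mul, mul_one, sub_self])
      rw [polar_sub_right, polar_smul_right, smul_eq_mul] at h1
      rw [polar_sub_left, polar_smul_left, smul_eq_mul, mul_comm, h1]
    have h2 : polar Q v f = 0 := by
      have := hv0
      rw [hvx, QuadraticMap.map_smul, smul_eq_mul, mul_eq_zero] at this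
      simpa [h0] using this
    rw [h2, zero_smul] at hvx
    exact Subtype.ext hvx

/-- The geometry of three vectors. -/
noncomputable def Geometry.ofVectors (Q : QuadraticForm K V) (hQ : Q.polarBilin.Nondegenerate)
    {x y z : V} (hx0 : x ≠ 0) (hy0 : y ≠ 0) (hz0 : z ≠ 0)
    (h : LinearIndependent K ![x, y, z]) (hx : Q x ≠ 0) (hyz : polar Q y z = 0)
    (hy : Q y ≠ 0 ∨ polar Q x y ≠ 0) (hz : Q z ≠ 0 ∨ polar Q x z ≠ 0) : Geometry K V where
  Q := Q
  Ω := Projectivization.mk K x hx0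
  P := Projectivization.mk K y hy0
  L := Projectivization.mk K z hz0
  nondegenerate := hQ
  radical_restrict := (radical_restrict_orthogonal_eq_bot_iff hQ _).2 hx
  orthogonal := by
    intro p hp l hl
    rw [Projectivization.submodule_mk, Submodule.mem_span_singleton] at hp hl
    obtain ⟨s, rfl⟩ := hp
    obtain ⟨t, rfl⟩ := hl
    rw [polar_smul_left, polar_smul_right, hyz, smul_zero, smul_zero]
  independent := (independent_mk_iff _ _ _).2 h
  nonsingular_P := by
    rw [map_rep_ne_zero_iff, arfPoints_mk, arfPair_eq_infty_iff.ne]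
    exact hy
  nonsingular_L := by
    rw [map_rep_ne_zero_iff, arfPoints_mk, arfPair_eq_infty_iff.ne]
    exact hz

theorem exists_smul_map_eq_one [PerfectField K] {Q : QuadraticForm K V} {x : V} (hx : Q x ≠ 0) :
    ∃ c : K, c ≠ 0 ∧ Q (c • x) = 1 := by
  obtain ⟨s, hs⟩ := surjective_frobenius K 2 (Q x)⁻¹
  rw [frobenius_def, pow_two] at hs
  refine ⟨s, ?_, ?_⟩
  · rintro rfl
    exact hx (by simpa using hs.symm)
  · rw [QuadraticMap.map_smul, hs, smul_eq_mul, inv_mul_cancel₀ hx]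

/-- A point has a representative that is normalized with respect to `Ω`. -/
theorem exists_normalized_rep [PerfectField K] {Q : QuadraticForm K V} {x : V} (hx : x ≠ 0)
    (hx1 : Q x = 1) {p : ℙ K V} (hp : Q p.rep ≠ 0 ∨ arfPoints Q (.mk K x hx) p ≠ ∞) :
    ∃ (y : V) (hy : y ≠ 0), Projectivization.mk K y hy = p ∧
      (arfPoints Q (.mk K x hx) p = ∞ ∧ polar Q x y = 0 ∧ Q y = 1 ∨
        arfPoints Q (.mk K x hx) p = ((Q y : K) : OnePoint K) ∧ polar Q x y = 1) := by
  induction p using Projectivization.ind with | _ y hy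
  rw [map_rep_ne_zero_iff, arfPoints_mk, arfPair_eq_infty_iff.ne] at hp
  rw [arfPoints_mk]
  by_cases h : polar Q x y = 0
  · obtain ⟨c, hc, hc1⟩ := exists_smul_map_eq_one (hp.resolve_right (not_not.2 h))
    refine ⟨c • y, smul_ne_zero hc hy, mk_smul hc hy, Or.inl ⟨?_, ?_, hc1⟩⟩
    · rwa [arfPair_eq_infty_iff]
    · rw [polar_smul_right, h, smul_zero]
  · have h1 : polar Q x ((polar Q x y)⁻¹ • y) = 1 := by
      rw [polar_smul_right, smul_eq_mul, inv_mul_cancel₀ h]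
    refine ⟨(polar Q x y)⁻¹ • y, smul_ne_zero (inv_ne_zero h) hy, mk_smul (inv_ne_zero h) hy,
      Or.inr ⟨?_, h1⟩⟩
    have h2 := arfPair_of_polar_eq_one h1
    rw [hx1, one_mul] at h2
    rw [← h2, ← arfPair_smul Q one_ne_zero (inv_ne_zero h), one_smul]

theorem Geometry.exists_rep_map_eq_one [PerfectField K] (G : Geometry K V) :
    ∃ (x : V) (hx : x ≠ 0), Projectivization.mk K x hx = G.Ω ∧ G.Q x = 1 := by
  have h := G.radical_restrict
  obtain ⟨x, hx, hΩ⟩ : ∃ (x : V) (hx : x ≠ 0), Projectivization.mk K x hx = G.Ω :=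
    ⟨_, G.Ω.rep_nonzero, G.Ω.mk_rep⟩
  rw [← hΩ, radical_restrict_orthogonal_eq_bot_iff G.nondegenerate] at h
  obtain ⟨c, hc, hc1⟩ := exists_smul_map_eq_one h
  exact ⟨c • x, smul_ne_zero hc hx, (mk_smul hc hx).trans hΩ, hc1⟩

theorem Geometry.existsUnique_rep_map_eq_one [PerfectField K] (G : Geometry K V) :
    ∃! ω : V, (∃ h : ω ≠ 0, Projectivization.mk K ω h = G.Ω) ∧ G.Q ω = 1 := by
  obtain ⟨x, hx, hΩ, hx1⟩ := G.exists_rep_map_eq_one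
  refine ⟨x, ⟨⟨hx, hΩ⟩, hx1⟩, ?_⟩
  rintro y ⟨⟨hy, hyΩ⟩, hy1⟩
  obtain ⟨c, rfl⟩ := (Projectivization.mk_eq_mk_iff' K _ _ _ _).1 (hyΩ.trans hΩ.symm)
  rw [QuadraticMap.map_smul, hx1, smul_eq_mul, mul_one] at hy1
  -- From `c² = 1` follows `c = 1`, as the Frobenius map is injective: there is no choice of sign.
  rw [frobenius_inj K 2 (a₁ := c) (a₂ := 1) (by rw [frobenius_def, pow_two, hy1, map_one]),
    one_smul]

/-- Normalized representatives of the points of a geometry. -/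
theorem Geometry.exists_normalized [PerfectField K] (G : Geometry K V) :
    ∃ (x y z : V) (hx : x ≠ 0) (hy : y ≠ 0) (hz : z ≠ 0), Projectivization.mk K x hx = G.Ω ∧
      Projectivization.mk K y hy = G.P ∧ Projectivization.mk K z hz = G.L ∧
      LinearIndependent K ![x, y, z] ∧ G.Q x = 1 ∧ polar G.Q y z = 0 ∧
      (arfPoints G.Q G.Ω G.P = ∞ ∧ polar G.Q x y = 0 ∧ G.Q y = 1 ∨
        arfPoints G.Q G.Ω G.P = ((G.Q y : K) : OnePoint K) ∧ polar G.Q x y = 1) ∧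
      (arfPoints G.Q G.Ω G.L = ∞ ∧ polar G.Q x z = 0 ∧ G.Q z = 1 ∨
        arfPoints G.Q G.Ω G.L = ((G.Q z : K) : OnePoint K) ∧ polar G.Q x z = 1) := by
  obtain ⟨x, hx, hΩ, hx1⟩ := G.exists_rep_map_eq_one
  have hP := G.nonsingular_P
  have hL := G.nonsingular_L
  rw [← hΩ] at hP hL
  obtain ⟨y, hy, hyP, hy'⟩ := exists_normalized_rep hx hx1 hP
  obtain ⟨z, hz, hzL, hz'⟩ := exists_normalized_rep hx hx1 hL
  rw [hΩ] at hy' hz'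
  refine ⟨x, y, z, hx, hy, hz, hΩ, hyP, hzL, ?_, hx1, ?_, hy', hz'⟩
  · rw [← independent_mk_iff hx hy hz, hΩ, hyP, hzL]
    exact G.independent
  · refine G.orthogonal y ?_ z ?_
    · rw [← hyP, Projectivization.submodule_mk]
      exact Submodule.mem_span_singleton_self y
    · rw [← hzL, Projectivization.submodule_mk]
      exact Submodule.mem_span_singleton_self z

/-- The geometry with `P` and `L` exchanged. -/
def Geometry.swap (G : Geometry K V) : Geometry K V where
  Q := G.Q
  Ω := G.Ω
  P := G.L
  L := G.P
  nondegenerate := G.nondegenerate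
  radical_restrict := G.radical_restrict
  orthogonal p hp l hl := by
    rw [polar_comm]
    exact G.orthogonal l hl p hp
  independent := by
    have h := G.independent
    rw [Projectivization.independent_iff] at h ⊢
    convert h.comp ![0, 2, 1] (by decide) using 1
    ext i
    fin_cases i <;> rfl
  nonsingular_P := G.nonsingular_L
  nonsingular_L := G.nonsingular_P

end Points

/-! ### The invariants of a geometry and the isometry criterion. -/

section Isometry

variable {K : Type w} [Field K] [CharP K 2]
variable {V : Type u} [AddCommGroup V] [Module K V]
variable {V' : Type v} [AddCommGroup V'] [Module K V']

theorem Geometry.exists_isArf [FiniteDimensional K V] (G : Geometry K V) :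
    ∃ n a, IsArf n G.Q a ∧ finrank K V = 2 * n := by
  obtain ⟨n, a, h⟩ := CharTwoGeometry.exists_isArf G.nondegenerate
  exact ⟨n, a, h, h.finrank⟩

theorem HasArf.isArf [FiniteDimensional K V] {Q : QuadraticForm K V} {a : K ⧸ frakH K}
    (h : HasArf Q a) {n : ℕ} (hn : finrank K V = 2 * n) : IsArf n Q a := by
  obtain ⟨m, hm⟩ := h.exists_isArf
  have := hm.finrank
  obtain rfl : m = n := by omega
  exact hm

theorem Geometry.existsUnique_hasArf [FiniteDimensional K V] (G : Geometry K V) :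
    ∃! a : K ⧸ frakH K, HasArf G.Q a := by
  obtain ⟨n, a, h, hn⟩ := G.exists_isArf
  exact ⟨a, h.hasArf, fun b hb => (hb.isArf hn).unique h⟩

/-- If both Arf values are `∞`, the three normalized vectors are mutually orthogonal with value one.
Adding `x` to the other two makes them singular, as Witt extension for triples requires. -/
theorem singular_add_add {Q : QuadraticForm K V} {x y z : V} (hx : Q x = 1) (hy : Q y = 1)
    (hz : Q z = 1) (hxy : polar Q x y = 0) (hxz : polar Q x z = 0) (hyz : polar Q y z = 0) :
    Q (y + x) = 0 ∧ Q (z + x) = 0 ∧ polar Q (z + x) (y + x) = 0 ∧ polar Q x (y + x) = 0 ∧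
      polar Q x (z + x) = 0 := by
  simp only [QuadraticMap.map_add Q, polar_add_left, polar_add_right, hx, hy, hz, hxy, hxz,
    polar_comm Q y x, polar_comm Q z x, polar_comm Q z y, hyz, polar_self_eq_zero,
    CharTwo.add_self_eq_zero, and_self]

theorem isIsometric_of_isArf [PerfectField K] [FiniteDimensional K V] [FiniteDimensional K V']
    {G : Geometry K V} {G' : Geometry K V'} {n : ℕ} {a : K ⧸ frakH K} (h : IsArf n G.Q a)
    (h' : IsArf n G'.Q a) (hP : arfPoints G.Q G.Ω G.P = arfPoints G'.Q G'.Ω G'.P)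
    (hL : arfPoints G.Q G.Ω G.L = arfPoints G'.Q G'.Ω G'.L) : G.IsIsometric G' := by
  obtain ⟨x, y, z, hx, hy, hz, hΩ, hyP, hzL, hli, hx1, hyz, nP, nL⟩ := G.exists_normalized
  obtain ⟨x', y', z', hx', hy', hz', hΩ', hyP', hzL', hli', hx1', hyz', nP', nL'⟩ :=
    G'.exists_normalized
  have hzy : polar G.Q z y = 0 := by rw [polar_comm, hyz]
  have hzy' : polar G'.Q z' y' = 0 := by rw [polar_comm, hyz']
  suffices hφ : ∃ φ : G.Q.IsometryEquiv G'.Q, φ x = x' ∧ φ y = y' ∧ φ z = z' by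
    obtain ⟨φ, h1, h2, h3⟩ := hφ
    refine ⟨φ, ?_, ?_, ?_⟩
    · rw [← hΩ, ← hΩ', Projectivization.map_mk]
      congr 1
    · rw [← hyP, ← hyP', Projectivization.map_mk]
      congr 1
    · rw [← hzL, ← hzL', Projectivization.map_mk]
      congr 1
  obtain ⟨hb, hq, hP'⟩ := eq_and_eq_of_normalized hP nP nP'
  obtain ⟨hb', hq', hL'⟩ := eq_and_eq_of_normalized hL nL nL'
  -- If one of the Arf values is finite, `Ω` and that point span a non-degenerate plane, and the
  -- other point supplies the third vector. If both are `∞`, no plane is available.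
  rcases hP' with h1 | ⟨h1, h1q⟩
  · exact h.exists_isometryEquiv_apply_eq_plane h' hli hli' h1 (hb ▸ h1) hyz hyz' hb'
      (hx1.trans hx1'.symm) hq hq'
  · rcases hL' with h2 | ⟨h2, h2q⟩
    · obtain ⟨φ, hφx, hφz, hφy⟩ := h.exists_isometryEquiv_apply_eq_plane h'
        (linearIndependent_swap hli) (linearIndependent_swap hli') h2 (hb' ▸ h2) hzy hzy' hb
        (hx1.trans hx1'.symm) hq' hq
      exact ⟨φ, hφx, hφy, hφz⟩
    · obtain ⟨s1, s2, s3, s4, s5⟩ := singular_add_add hx1 h1q h2q h1 h2 hyz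
      obtain ⟨s1', s2', s3', s4', s5'⟩ := singular_add_add hx1' (hq ▸ h1q) (hq' ▸ h2q) (hb ▸ h1)
        (hb' ▸ h2) hyz'
      obtain ⟨φ, h3, h4, h5⟩ := h.exists_isometryEquiv_apply_eq_triple h'
        (linearIndependent_add_add hli) (linearIndependent_add_add hli') s1 s1' s2 s2'
        (hx1.trans hx1'.symm) s3 s3' s4 s4' s5 s5'
      rw [map_add, h5] at h3 h4
      exact ⟨φ, h5, add_right_cancel h3, add_right_cancel h4⟩

theorem Geometry.isIsometric_iff [PerfectField K] [FiniteDimensional K V] [FiniteDimensional K V']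
    (G : Geometry K V) (G' : Geometry K V') (hd : finrank K V = finrank K V') :
    G.IsIsometric G' ↔
      (∃ a : K ⧸ frakH K, HasArf G.Q a ∧ HasArf G'.Q a) ∧
      arfPoints G.Q G.Ω G.P = arfPoints G'.Q G'.Ω G'.P ∧
      arfPoints G.Q G.Ω G.L = arfPoints G'.Q G'.Ω G'.L := by
  constructor
  · rintro ⟨φ, hΩ, hP, hL⟩
    obtain ⟨a, ha, -⟩ := G.existsUnique_hasArf
    refine ⟨⟨a, ha, ha.of_isometryEquiv φ⟩, ?_, ?_⟩
    · rw [← hΩ, ← hP, arfPoints_map]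
    · rw [← hΩ, ← hL, arfPoints_map]
  · rintro ⟨⟨a, ha, ha'⟩, hP, hL⟩
    obtain ⟨n, -, -, hn⟩ := G.exists_isArf
    exact isIsometric_of_isArf (ha.isArf hn) (ha'.isArf (hd ▸ hn)) hP hL

/-- The dimension is twice the number of planes, and three independent points exclude dimension two.
-/
theorem Geometry.even_finrank_and_four_le [FiniteDimensional K V] (G : Geometry K V) :
    Even (finrank K V) ∧ 4 ≤ finrank K V := by
  obtain ⟨n, -, -, hn⟩ := G.exists_isArf
  have := G.three_le_finrank
  exact ⟨⟨n, by omega⟩, by omega⟩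

end Isometry

/-! ### Geometries with prescribed invariants, and the constraint in dimension four. -/

section Existence

variable {K : Type w} [Field K] [CharP K 2]
variable {V : Type u} [AddCommGroup V] [Module K V]
variable {W : Type v} [AddCommGroup W] [Module K W]

theorem polar_planeForm (a c : K) (x y : K × K) :
    polar (planeForm a c) x y = x.1 * y.2 + x.2 * y.1 := by
  simp only [polar, planeForm_apply, Prod.fst_add, Prod.snd_add]
  linear_combination (a * x.1 * y.1 + c * x.2 * y.2) * CharTwo.two_eq_zero (R := K)

theorem IsArf.planeForm_prod {n : ℕ} {R : QuadraticForm K W} {r : K ⧸ frakH K} (h : IsArf n R r)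
    (a c : K) : IsArf (n + 1) ((planeForm a c).prod R) (((a * c : K) : K ⧸ frakH K) + r) := by
  have hmem : ∀ x : (K × K) × W, x ∈ planeComplement ((planeForm a c).prod R)
      ((1, 0), 0) ((0, 1), 0) ↔ x.1 = 0 := by
    intro x
    rw [mem_planeComplement, polar_prod, polar_prod, polar_planeForm, polar_planeForm, Prod.ext_iff]
    simp [and_comm]
  let φ : R.IsometryEquiv (((planeForm a c).prod R).restrict
      (planeComplement ((planeForm a c).prod R) ((1, 0), 0) ((0, 1), 0))) :=
    { toFun := fun x => ⟨(0, x), (hmem _).2 rfl⟩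
      invFun := fun x => x.1.2
      map_add' := fun x y => by ext <;> simp
      map_smul' := fun t x => by ext <;> simp
      left_inv := fun x => rfl
      right_inv := fun x => Subtype.ext (Prod.ext ((hmem _).1 x.2).symm rfl)
      map_app' := fun x => by
        change (planeForm a c).prod R (0, x) = R x
        simp [prod_apply] }
  refine ⟨((1, 0), 0), ((0, 1), 0), ?_, r, h.of_isometryEquiv φ, ?_⟩
  · simp [polar_planeForm]
  · simp [planeForm_apply]

theorem exists_isArf_zero (n : ℕ) : ∃ (W : Type w) (_ : AddCommGroup W) (_ : Module K W)
    (_ : FiniteDimensional K W) (R : QuadraticForm K W), IsArf n R 0 := by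
  induction n with
  | zero => exact ⟨PUnit, inferInstance, inferInstance, inferInstance, 0, inferInstance, rfl⟩
  | succ n ih =>
    obtain ⟨W, _, _, _, R, hR⟩ := ih
    exact ⟨(K × K) × W, inferInstance, inferInstance, inferInstance, (planeForm 0 0).prod R, by
      simpa using hR.planeForm_prod 0 0⟩

theorem exists_isArf_mk (n : ℕ) (r : K) (h : n ≠ 0 ∨ r = 0) :
    ∃ (W : Type w) (_ : AddCommGroup W) (_ : Module K W) (_ : FiniteDimensional K W)
      (R : QuadraticForm K W), IsArf n R (r : K ⧸ frakH K) := by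
  cases n with
  | zero =>
    obtain rfl : r = 0 := by simpa using h
    exact exists_isArf_zero 0
  | succ n =>
    obtain ⟨W, _, _, _, R, hR⟩ := exists_isArf_zero (K := K) n
    exact ⟨(K × K) × W, inferInstance, inferInstance, inferInstance, (planeForm 1 r).prod R, by
      simpa using hR.planeForm_prod 1 r⟩

/-- Three suitable vectors in some quadratic space give a geometry on every space of the same
dimension. -/
theorem exists_geometry_of_vectors [FiniteDimensional K V] [FiniteDimensional K W] {n : ℕ}
    (hV : finrank K V = 2 * n) {R : QuadraticForm K W} {a : K ⧸ frakH K} (hR : IsArf n R a)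
    {x y z : W} (h : LinearIndependent K ![x, y, z]) (hx : R x ≠ 0) (hyz : polar R y z = 0)
    (hy : R y ≠ 0 ∨ polar R x y ≠ 0) (hz : R z ≠ 0 ∨ polar R x z ≠ 0) :
    ∃ G : Geometry K V, HasArf G.Q a ∧ arfPoints G.Q G.Ω G.P = arfPair R x y ∧
      arfPoints G.Q G.Ω G.L = arfPair R x z := by
  let e : V ≃ₗ[K] W := LinearEquiv.ofFinrankEq V W (hV.trans hR.finrank.symm)
  let Q : QuadraticForm K V := R.comp e.toLinearMap
  let φ : R.IsometryEquiv Q :=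
    { toLinearEquiv := e.symm
      map_app' := fun x => congrArg R (e.apply_symm_apply x) }
  have hQ : IsArf n Q a := hR.of_isometryEquiv φ
  have hli : LinearIndependent K ![φ x, φ y, φ z] := by
    have hφ : φ.toLinearEquiv.toLinearMap ∘ ![x, y, z] = ![φ x, φ y, φ z] := by
      funext i
      fin_cases i <;> rfl
    exact hφ ▸ h.map' φ.toLinearEquiv.toLinearMap φ.toLinearEquiv.ker
  have harf : ∀ x y : W, arfPair Q (φ x) (φ y) = arfPair R x y := by
    intro x y
    unfold arfPair
    rw [polar_isometryEquiv, φ.map_app, φ.map_app]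
  refine ⟨.ofVectors Q hQ.nondegenerate (x := φ x) (y := φ y) (z := φ z) (hli.ne_zero 0)
    (hli.ne_zero 1) (hli.ne_zero 2) hli
    (by rwa [φ.map_app]) (by rwa [polar_isometryEquiv])
    (by rwa [φ.map_app, polar_isometryEquiv]) (by rwa [φ.map_app, polar_isometryEquiv]),
    hQ.hasArf, ?_, ?_⟩
  · exact (arfPoints_mk Q _ _).trans (harf x y)
  · exact (arfPoints_mk Q _ _).trans (harf x z)

/-- In an orthogonal sum of planes with bases `e₁, f₁` and `e₂, f₂` and a rest `R`, take `Ω = e₁`,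
`P = f₁`, `L = t f₁ + e₂`, with `Q(e₁) = 1`, `Q(f₁) = α`, `Q(e₂) = d`. The parameters `t` and `d`
produce `β`; `Q(f₂)` and the rest remain free to adjust the Arf class. -/
theorem exists_geometry_coe_left [FiniteDimensional K V] {m : ℕ}
    (hV : finrank K V = 2 * (m + 2)) (a : K ⧸ frakH K) (α : K) (β : OnePoint K)
    (h : (α : OnePoint K) ≠ β ∨ m ≠ 0 ∨ a = (α : K ⧸ frakH K)) :
    ∃ G : Geometry K V, HasArf G.Q a ∧ arfPoints G.Q G.Ω G.P = (α : OnePoint K) ∧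
      arfPoints G.Q G.Ω G.L = β := by
  obtain ⟨t, d, hβ⟩ : ∃ t d : K, t = 0 ∧ d = 1 ∧ β = ∞ ∨
      t = 1 ∧ β = ((d + α : K) : OnePoint K) := by
    induction β using OnePoint.rec with
    | infty => exact ⟨0, 1, Or.inl ⟨rfl, rfl, rfl⟩⟩
    | coe b => exact ⟨1, b - α, Or.inr ⟨rfl, by rw [sub_add_cancel]⟩⟩
  -- The total class is that of `α + d y + r`. If `d ≠ 0`, then `y = Q(f₂)` alone reaches every
  -- class. If `d = 0`, which means `α = β`, only `r` can contribute, and it must vanish when there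
  -- is no further plane.
  obtain ⟨y, r, hr, hyr⟩ : ∃ y r : K, (m ≠ 0 ∨ r = 0) ∧
      a = ((1 * α : K) : K ⧸ frakH K) + (((d * y : K) : K ⧸ frakH K) + (r : K ⧸ frakH K)) := by
    induction a using QuotientAddGroup.induction_on with | H s
    by_cases hd : d = 0
    · rcases h with h | h | h
      · rcases hβ with ⟨-, h1, -⟩ | ⟨-, rfl⟩
        · exact absurd (hd.symm.trans h1) zero_ne_one
        · rw [hd, zero_add] at h
          exact absurd rfl h
      · refine ⟨0, s - α, Or.inl h, ?_⟩
        rw [← QuotientAddGroup.mk_add, ← QuotientAddGroup.mk_add]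
        congr 1
        ring
      · exact ⟨0, 0, Or.inr rfl, by rw [h]; simp⟩
    · refine ⟨(s - α) / d, 0, Or.inr rfl, ?_⟩
      rw [← QuotientAddGroup.mk_add, ← QuotientAddGroup.mk_add]
      congr 1
      field_simp
      ring
  obtain ⟨W, _, _, _, R, hR⟩ := exists_isArf_mk m r hr
  have hM := (hR.planeForm_prod d y).planeForm_prod 1 α
  rw [← hyr] at hM
  set M := (planeForm 1 α).prod ((planeForm d y).prod R) with hMdef
  have hMx : M ((1, 0), ((0, 0), 0)) = 1 := by simp [hMdef, planeForm_apply]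
  have hMy : M ((0, 1), ((0, 0), 0)) = α := by simp [hMdef, planeForm_apply]
  have hMz : M ((0, t), ((1, 0), 0)) = d + α * t ^ 2 := by
    simp [hMdef, planeForm_apply, add_comm]
  have hxy : polar M ((1, 0), ((0, 0), 0)) ((0, 1), ((0, 0), 0)) = 1 := by
    simp [hMdef, polar_planeForm, CharTwo.two_eq_zero]
  have hxz : polar M ((1, 0), ((0, 0), 0)) ((0, t), ((1, 0), 0)) = t := by
    simp [hMdef, polar_planeForm]
  have hyz : polar M ((0, 1), ((0, 0), 0)) ((0, t), ((1, 0), 0)) = 0 := by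
    simp [hMdef, polar_planeForm]
  obtain ⟨G, hG, hP, hL⟩ := exists_geometry_of_vectors hV hM (x := ((1, 0), ((0, 0), 0)))
    (y := ((0, 1), ((0, 0), 0))) (z := ((0, t), ((1, 0), 0))) (by
      rw [Fintype.linearIndependent_iff]
      intro g hg
      simp only [Fin.sum_univ_three, Matrix.cons_val, Prod.smul_mk, Prod.mk_add_mk, Prod.ext_iff,
        smul_eq_mul, mul_one, mul_zero, add_zero, zero_add, Prod.fst_zero, Prod.snd_zero] at hg
      obtain ⟨⟨h0, h1⟩, ⟨h2, -⟩, -⟩ := hg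
      rw [Fin.forall_fin_succ, Fin.forall_fin_two]
      exact ⟨h0, by simpa [h2] using h1, h2⟩)
    (by rw [hMx]; exact one_ne_zero) hyz (Or.inr (by rw [hxy]; exact one_ne_zero)) (by
      rw [hxz, hMz]
      rcases hβ with ⟨rfl, rfl, -⟩ | ⟨rfl, -⟩ <;> simp)
  refine ⟨G, hG, hP.trans ?_, hL.trans ?_⟩
  · rw [arfPair_of_polar_eq_one hxy, hMx, hMy, one_mul]
  · rcases hβ with ⟨rfl, rfl, rfl⟩ | ⟨rfl, rfl⟩
    · rw [arfPair_eq_infty_iff, hxz]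
    · rw [arfPair_of_polar_eq_one hxz, hMx, hMz, one_pow, mul_one, one_mul]

/-- The vectors `e₁`, `e₁ + e₂`, `e₁ + e₃` from three planes, with `Q(e₁) = 1` and `e₂`, `e₃`
singular, are mutually orthogonal with value one. The value `s` at `f₁` carries the Arf class. -/
theorem exists_geometry_infty [FiniteDimensional K V] {m : ℕ}
    (hV : finrank K V = 2 * (m + 3)) (a : K ⧸ frakH K) :
    ∃ G : Geometry K V, HasArf G.Q a ∧ arfPoints G.Q G.Ω G.P = ∞ ∧
      arfPoints G.Q G.Ω G.L = ∞ := by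
  induction a using QuotientAddGroup.induction_on with | H s
  obtain ⟨W, _, _, _, R, hR⟩ := exists_isArf_zero (K := K) m
  have hM := ((hR.planeForm_prod 0 0).planeForm_prod 0 0).planeForm_prod 1 s
  set M := (planeForm 1 s).prod ((planeForm 0 0).prod ((planeForm 0 0).prod R)) with hMdef
  have hMx : M ((1, 0), ((0, 0), ((0, 0), 0))) = 1 := by simp [hMdef, planeForm_apply]
  have hMy : M ((1, 0), ((1, 0), ((0, 0), 0))) = 1 := by simp [hMdef, planeForm_apply]
  have hMz : M ((1, 0), ((0, 0), ((1, 0), 0))) = 1 := by simp [hMdef, planeForm_apply]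
  have hxy : polar M ((1, 0), ((0, 0), ((0, 0), 0))) ((1, 0), ((1, 0), ((0, 0), 0))) = 0 := by
    simp [hMdef, polar_planeForm, CharTwo.two_eq_zero]
  have hxz : polar M ((1, 0), ((0, 0), ((0, 0), 0))) ((1, 0), ((0, 0), ((1, 0), 0))) = 0 := by
    simp [hMdef, polar_planeForm, CharTwo.two_eq_zero]
  have hyz : polar M ((1, 0), ((1, 0), ((0, 0), 0))) ((1, 0), ((0, 0), ((1, 0), 0))) = 0 := by
    simp [hMdef, polar_planeForm, CharTwo.two_eq_zero]
  obtain ⟨G, hG, hP, hL⟩ := exists_geometry_of_vectors hV hM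
    (x := ((1, 0), ((0, 0), ((0, 0), 0)))) (y := ((1, 0), ((1, 0), ((0, 0), 0))))
    (z := ((1, 0), ((0, 0), ((1, 0), 0)))) (by
      rw [Fintype.linearIndependent_iff]
      intro g hg
      simp only [Fin.sum_univ_three, Matrix.cons_val, Prod.smul_mk, Prod.mk_add_mk, Prod.ext_iff,
        smul_eq_mul, mul_one, mul_zero, add_zero, zero_add, Prod.fst_zero, Prod.snd_zero] at hg
      obtain ⟨⟨h0, -⟩, ⟨h1, -⟩, ⟨h2, -⟩, -⟩ := hg
      rw [Fin.forall_fin_succ, Fin.forall_fin_two]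
      exact ⟨by simpa [h1, h2] using h0, h1, h2⟩)
    (by rw [hMx]; exact one_ne_zero) hyz (Or.inl (by rw [hMy]; exact one_ne_zero))
    (Or.inl (by rw [hMz]; exact one_ne_zero))
  refine ⟨G, ?_, hP.trans (arfPair_eq_infty_iff.2 hxy), hL.trans (arfPair_eq_infty_iff.2 hxz)⟩
  simpa using hG

theorem exists_geometry [FiniteDimensional K V] {m : ℕ} (hV : finrank K V = 2 * (m + 2))
    (a : K ⧸ frakH K) (α β : OnePoint K) (h : α ≠ β ∨ m ≠ 0 ∨
      ∃ c : K, α = (c : OnePoint K) ∧ β = (c : OnePoint K) ∧ a = (c : K ⧸ frakH K)) :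
    ∃ G : Geometry K V, HasArf G.Q a ∧ arfPoints G.Q G.Ω G.P = α ∧
      arfPoints G.Q G.Ω G.L = β := by
  induction α using OnePoint.rec with
  | coe α =>
    refine exists_geometry_coe_left hV a α β (h.imp_right (Or.imp_right ?_))
    rintro ⟨c, hα, -, hac⟩
    rw [hac, OnePoint.coe_injective hα]
  | infty =>
    induction β using OnePoint.rec with
    | coe β =>
      obtain ⟨G, hG, hP, hL⟩ := exists_geometry_coe_left hV a β ∞ (Or.inl (OnePoint.coe_ne_infty β))
      exact ⟨G.swap, hG, hL, hP⟩
    | infty =>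
      have hm : m ≠ 0 := by
        rcases h with h | h | ⟨c, hc, -⟩
        · exact absurd rfl h
        · exact h
        · exact absurd hc.symm (OnePoint.coe_ne_infty c)
      obtain ⟨k, rfl⟩ := Nat.exists_eq_succ_of_ne_zero hm
      exact exists_geometry_infty hV a

theorem Geometry.exists_eq_coe_of_finrank_eq_four [PerfectField K] [FiniteDimensional K V]
    (hV : finrank K V = 4) (G : Geometry K V) {a : K ⧸ frakH K} (ha : HasArf G.Q a)
    (h : arfPoints G.Q G.Ω G.P = arfPoints G.Q G.Ω G.L) :
    ∃ c : K, arfPoints G.Q G.Ω G.P = (c : OnePoint K) ∧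
      arfPoints G.Q G.Ω G.L = (c : OnePoint K) ∧ a = (c : K ⧸ frakH K) := by
  obtain ⟨x, y, z, hx, hy, hz, hΩ, hyP, hzL, hli, hx1, hyz, nP, nL⟩ := G.exists_normalized
  have harf : IsArf 2 G.Q a := ha.isArf hV
  rcases nP with ⟨hP, hxy, hy1⟩ | ⟨hP, hxy⟩
  · exfalso
    rcases nL with ⟨hL, hxz, hz1⟩ | ⟨hL, -⟩
    -- On the span of the three vectors `B` vanishes, so it has dimension at most half of four,
    -- contradicting independence.
    · set S := Submodule.span K (Set.range ![x, y, z]) with hS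
      have h3 : finrank K S = 3 := by
        rw [finrank_span_eq_card hli, Fintype.card_fin]
      have hle : S ≤ LinearMap.BilinForm.orthogonal G.Q.polarBilin S := by
        have hgen : ∀ i j, polar G.Q (![x, y, z] i) (![x, y, z] j) = 0 := by
          simp only [Fin.forall_fin_succ, Fin.forall_fin_zero, and_true]
          simp [hxy, hxz, hyz, polar_comm G.Q y x, polar_comm G.Q z x,
            polar_comm G.Q z y, CharTwo.two_eq_zero]
        intro v hv u hu
        change polar G.Q u v = 0
        induction hu using Submodule.span_induction with
        | mem u hu =>
          obtain ⟨i, rfl⟩ := hu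
          induction hv using Submodule.span_induction with
          | mem v hv =>
            obtain ⟨j, rfl⟩ := hv
            exact hgen i j
          | zero => simp
          | add v v' _ _ h1 h2 => rw [polar_add_right, h1, h2, add_zero]
          | smul t v _ h1 => rw [polar_smul_right, h1, smul_zero]
        | zero => simp
        | add u u' _ _ h1 h2 => rw [polar_add_left, h1, h2, add_zero]
        | smul t u _ h1 => rw [polar_smul_left, h1, smul_zero]
      have h4 := Submodule.finrank_mono hle
      rw [LinearMap.BilinForm.finrank_orthogonal G.nondegenerate, h3, hV] at h4
      omega
    · exact OnePoint.coe_ne_infty _ ((hL.symm.trans h.symm).trans hP)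
  · rcases nL with ⟨hL, -, -⟩ | ⟨hL, hxz⟩
    · exact absurd ((hP.symm.trans h).trans hL) (OnePoint.coe_ne_infty _)
    · have hyz' : G.Q y = G.Q z := OnePoint.coe_injective ((hP.symm.trans h).trans hL)
      refine ⟨G.Q y, hP, hyz' ▸ hL, ?_⟩
      have hc := harf.exists_planeComplement hxy
      have hu : z + (1 : K) • y ∈ planeComplement G.Q x y := mem_planeComplement.2 (by
        simp [polar_add_right, hxy, hxz, hyz, CharTwo.two_eq_zero,
          CharTwo.add_self_eq_zero])
      have hQu : G.Q (z + (1 : K) • y) = 0 := by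
        rw [one_smul, QuadraticMap.map_add G.Q, polar_comm, hyz, add_zero, hyz',
          CharTwo.add_self_eq_zero]
      obtain ⟨v, hv⟩ := exists_polar_eq_one hc.nondegenerate (x := ⟨_, hu⟩)
        (fun h0 => add_smul_ne_zero hli 1 (congrArg Subtype.val h0))
      -- The complement of the plane of `x`, `y` is the plane of the singular vector `z + y` and
      -- `v`. Splitting it off leaves the zero space, whose Arf class is zero, so `a` is the class
      -- of `Q(x) Q(y) = Q(y)`.
      have h0 := (hc.exists_planeComplement hv).2
      rw [restrict_apply] at h0
      simp only [hQu, zero_mul, hx1, one_mul] at h0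
      rw [QuotientAddGroup.mk_zero, sub_zero, sub_eq_zero] at h0
      exact h0

end Existence

end CharTwoGeometry

/-! ### The theorem. -/

open CharTwoGeometry in
theorem mainTheorem1 {K V V' : Type*} [Field K] [CharP K 2] [PerfectField K]
    [AddCommGroup V] [Module K V] [FiniteDimensional K V]
    [AddCommGroup V'] [Module K V'] [FiniteDimensional K V'] :
    -- the Arf invariant of the space of a geometry is a well-defined element of `K / 𝔥(K)`
    (∀ G : Geometry K V, ∃! a : K ⧸ frakH K, HasArf G.Q a) ∧
    -- the three values determine the geometry up to isometry, in every dimension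
    (∀ (G : Geometry K V) (G' : Geometry K V'),
      Module.finrank K V = Module.finrank K V' →
      (G.IsIsometric G' ↔
        (∃ a : K ⧸ frakH K, HasArf G.Q a ∧ HasArf G'.Q a) ∧
        arfPoints G.Q G.Ω G.P = arfPoints G'.Q G'.Ω G'.P ∧
        arfPoints G.Q G.Ω G.L = arfPoints G'.Q G'.Ω G'.L)) ∧
    -- `Ω` has exactly one representative on which `Q` takes the value one
    (∀ G : Geometry K V, ∃! ω : V, (∃ h : ω ≠ 0, Projectivization.mk K ω h = G.Ω) ∧ G.Q ω = 1) ∧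
    -- the dimension is even and at least four
    (∀ _ : Geometry K V, Even (Module.finrank K V) ∧ 4 ≤ Module.finrank K V) ∧
    -- in dimension at least six, arbitrary values can be prescribed
    (Even (Module.finrank K V) → 6 ≤ Module.finrank K V →
      ∀ (a : K ⧸ frakH K) (α β : OnePoint K), ∃ G : Geometry K V,
        HasArf G.Q a ∧ arfPoints G.Q G.Ω G.P = α ∧ arfPoints G.Q G.Ω G.L = β) ∧
    -- in dimension four, these values occur, and no others
    (Module.finrank K V = 4 →
      ∀ (a : K ⧸ frakH K) (α β : OnePoint K),
        (∃ G : Geometry K V,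
          HasArf G.Q a ∧ arfPoints G.Q G.Ω G.P = α ∧ arfPoints G.Q G.Ω G.L = β) ↔
        (α ≠ β ∨ ∃ c : K, α = (c : OnePoint K) ∧ β = (c : OnePoint K) ∧
          a = (c : K ⧸ frakH K))) := by
  refine ⟨fun G => G.existsUnique_hasArf, fun G G' hd => G.isIsometric_iff G' hd,
    fun G => G.existsUnique_rep_map_eq_one, fun G => G.even_finrank_and_four_le, ?_, ?_⟩
  · rintro ⟨k, hk⟩ h6 a α β
    obtain ⟨m, rfl⟩ : ∃ m, k = m + 3 := ⟨k - 3, by omega⟩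
    -- Dimension at least six leaves at least one plane beyond the two of the model.
    exact exists_geometry (m := m + 1) (by omega) a α β (Or.inr (Or.inl m.succ_ne_zero))
  · intro hV a α β
    constructor
    · rintro ⟨G, ha, rfl, rfl⟩
      by_cases h : arfPoints G.Q G.Ω G.P = arfPoints G.Q G.Ω G.L
      · exact Or.inr (G.exists_eq_coe_of_finrank_eq_four hV ha h)
      · exact Or.inl h
    · intro h
      exact exists_geometry (m := 0) hV a α β (h.imp_right Or.inr)
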